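/- Let $\Theta_t(x)=(4\pi t)^{-1/2}e^{-x^2/(4t)}$ for $x\in\mathbb R$, $t>0$. Let $\mathcal B_c$ be the space of continuous functions $F:[-\infty,\infty]\to\mathbb R$ with $F(-\infty)=0$, and let $\mathcal A_c$ be the space of real distributions on $\mathbb R$ of the form $f=F'$ (distributional derivative) with $F\in\mathcal B_c$; the primitive $F$ is unique. For $f\in\mathcal A_c$ put $\int_a^b f=F(b)-F(a)$ for $a,b\in[-\infty,\infty]$, and let $\|f\|=\sup_{x<y}\left|\int_x^y f\right|$ be the Alexiewicz norm. For $g:\mathbb R\to\mathbb R$ of bounded variation put $\int_{-\infty}^\infty fg=F(\infty)g(\infty)-\int_{-\infty}^\infty F\,dg$, the last integral being a Henstock–Stieltjes integral over $[-\infty,\infty]$ with $g(\pm\infty)=\lim_{x\to\pm\infty}g(x)$. Let $f*\Theta_t(x)=\int_{-\infty}^\infty f(x-\xi)\Theta_t(\xi)\,d\xi$ and $\Theta_t*f(x)=\int_{-\infty}^\infty f(\xi)\Theta_t(x-\xi)\,d\xi$ in this sense, where $\langle f(x-\cdot),\varphi\rangle=\langle f,\varphi(x-\cdot)\rangle$ for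 test functions $\varphi$. A locally integrable function is identified with the distribution it defines. **Theorem.** Let $f\in\mathcal A_c$ with primitive $F\in\mathcal B_c$. (a) For all $x\in\mathbb R$ and $t>0$ the integrals $f*\Theta_t(x)$, $\Theta_t*f(x)$, $F*\Theta_t'(x)$ and $F*\Theta_t(x)$ exist (the last two as Lebesgue integrals), $F*\Theta_t$ is differentiable at $x$, and $f*\Theta_t(x)=\Theta_t*f(x)=F*\Theta_t'(x)=(F*\Theta_t)'(x)$. (b) $(x,t)\mapsto f*\Theta_t(x)$ is $C^\infty$ on $\mathbb R\times(0,\infty)$. (c) For each $t>0$, $\|f*\Theta_t\|_\infty\le\|f\|/(2\sqrt{\pi t})$, and $1/(2\sqrt{\pi t})$ is the least constant for which this holds for all $f\in\mathcal A_c$. (d) For each $t>0$, $\Phi_t(f)=f*\Theta_t$ defines a bounded linear operator from $\mathcal A_c$ to $C([-\infty,\infty])$ (real continuous functions with the supremum norm), and $\|\Phi_t\|=1/(2\sqrt{\pi t})$. (e) For each $t>0$, $\lim_{|x|\to\infty}f*\Theta_t(x)=0$. (f) For each $t>0$, $f*\Theta_t\in\mathcal A_c$ and $\|f*\Theta_t\|\le\|f\|$,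 and $1$ is the least constant for which this holds for all $f\in\mathcal A_c$. The linear operator $\Psi_t:\mathcal A_c\to\mathcal A_c$, $\Psi_t(f)=f*\Theta_t$, has norm $\|\Psi_t\|=1$. (g) The function $u(x,t)=f*\Theta_t(x)$ is $C^2$ in $x\in\mathbb R$ and $C^1$ in $t\in(0,\infty)$, satisfies $\partial u/\partial t-\partial^2u/\partial x^2=0$ on $\mathbb R\times(0,\infty)$, and $\|u(\cdot,t)-f\|\to0$ as $t\to0^+$. (h) For each $t>0$, $\int_{-\infty}^\infty f*\Theta_t=\int_{-\infty}^\infty f$. (i) $f*\Theta_t$ need not be in any $L^p$ space with $p<\infty$: there is an $f\in\mathcal A_c$ such that for every $t>0$ and every $1\le p<\infty$ the function $f*\Theta_t$ is not in $L^p(\mathbb R)$. (j) For each $t>0$, $f*\Theta_t(x)$ is real analytic as a function of $x\in\mathbb R$. For each $x\in\mathbb R$, $f*\Theta_t(x)$ is real analytic as a function of $t>0$. -/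

import Mathlib

open scoped Distributions LineDeriv ContDiff Topology ENNReal

namespace HeatAlex

open MeasureTheory Filter Set

noncomputable section

/-! ### Distributions on the line -/

/-- Real Schwartz distributions on `ℝ`. -/
abbrev Dist : Type := Distribution (⊤ : TopologicalSpace.Opens ℝ) ℝ ⊤

/-- Test functions `C_c^∞(ℝ)`. -/
abbrev Test : Type := TestFunction (⊤ : TopologicalSpace.Opens ℝ) ℝ ⊤

/-- The distribution `φ ↦ ∫ φ(x) g(x) dx` of a locally integrable function `g`
(the zero distribution if `g` is not locally integrable). -/
def ofFun (g : ℝ → ℝ) : Dist :=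
  TestFunction.integralAgainstBilinCLM (ContinuousLinearMap.mul ℝ ℝ) volume g

theorem ofFun_apply {g : ℝ → ℝ} (hg : LocallyIntegrable g volume) (φ : Test) :
    ofFun g φ = ∫ x, φ x * g x := by
  have h : LocallyIntegrableOn g ((⊤ : TopologicalSpace.Opens ℝ) : Set ℝ) volume := by
    simpa using hg.locallyIntegrableOn univ
  exact TestFunction.integralAgainstBilinCLM_eq_integral h

/-- The change of variables `φ ↦ φ(x - ·)` on test functions. -/
def reflTest (x : ℝ) : Test →L[ℝ] Test :=
  TestFunction.limitCLM ℝ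
    (fun φ => ⟨fun ξ => φ (x - ξ), φ.contDiff.comp (contDiff_const.sub contDiff_id),
      φ.hasCompactSupport.comp_homeomorph (Homeomorph.subLeft x), by simp⟩)
    (fun K _ =>
      TestFunction.ofSupportedInCLM ℝ
          (K := K.map (Homeomorph.subLeft x) (Homeomorph.subLeft x).continuous) (by simp) ∘L
        ContDiffMapSupportedIn.mkCLM ℝ (fun φ ξ => φ (x - ξ))
          (fun _ _ _ => rfl) (fun _ _ _ => rfl)
          (fun φ => φ.contDiff.comp (contDiff_const.sub contDiff_id))
          (fun φ ξ hξ => φ.zero_on_compl (fun h => hξ ⟨x - ξ, h, by simp⟩))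
          (fun i _ => ⟨{i}, 1, zero_le_one, fun φ ξ _ => by
            have h1 : (fun ξ => φ (x - ξ)) =
                (fun η => φ (x + η)) ∘ (LinearIsometryEquiv.neg ℝ : ℝ ≃ₗᵢ[ℝ] ℝ) := by
              ext ξ; simp [sub_eq_add_neg]
            rw [h1, LinearIsometryEquiv.norm_iteratedFDeriv_comp_right,
              iteratedFDeriv_comp_add_left]
            simpa using ContDiffMapSupportedIn.norm_iteratedFDeriv_apply_le_seminorm_top ℝ⟩))
    (fun _ _ _ => rfl)

theorem reflTest_apply (x : ℝ) (φ : Test) (ξ : ℝ) : reflTest x φ ξ = φ (x - ξ) := rfl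

/-- The distribution `f(x - ·)`, i.e. `⟨f(x - ·), φ⟩ = ⟨f, φ(x - ·)⟩`. -/
def reflect (x : ℝ) (f : Dist) : Dist :=
  ContinuousLinearMap.comp (f : Test →L[ℝ] ℝ) (reflTest x)

/-! ### Primitives and the Alexiewicz space -/

/-- `B_c`: continuous real functions on the extended real line that vanish at `-∞`. -/
def Bc : Submodule ℝ C(EReal, ℝ) where
  carrier := {F | F ⊥ = 0}
  add_mem' := by
    intro F G hF hG
    simp only [mem_ofPred_eq] at *
    simp [hF, hG]
  zero_mem' := rfl
  smul_mem' := by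
    intro c F hF
    simp only [mem_ofPred_eq] at *
    simp [hF]

theorem continuous_restrict (F : C(EReal, ℝ)) : Continuous (fun x : ℝ => F (x : EReal)) :=
  F.continuous.comp continuous_coe_real_ereal

/-- The distributional derivative of (the restriction to `ℝ` of) `F`. -/
def distDeriv (F : C(EReal, ℝ)) : Dist :=
  ∂_{(1 : ℝ)} (ofFun (fun x : ℝ => F (x : EReal)))

theorem distDeriv_apply (F : C(EReal, ℝ)) (φ : Test) :
    distDeriv F φ = -∫ x : ℝ, F (x : EReal) * deriv φ x := by
  rw [distDeriv, Distribution.lineDerivOp_apply_apply, map_neg,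
    ofFun_apply (continuous_restrict F).locallyIntegrable]
  congr 1
  refine integral_congr_ae (Eventually.of_forall fun x => ?_)
  have : (∂_{(1 : ℝ)} φ : Test) x = deriv φ x := by
    rw [TestFunction.lineDerivOp_eq_lineDerivCLM ℝ, TestFunction.lineDerivCLM_apply_of_le]
    · simp [lineDeriv, deriv_comp_const_add]
    · simp
  simp only [this]
  ring

theorem distDeriv_add (F G : C(EReal, ℝ)) : distDeriv (F + G) = distDeriv F + distDeriv G := by
  ext φ
  have key : ∀ H : C(EReal, ℝ), Integrable (fun x : ℝ => H (x : EReal) * deriv φ x) := fun H =>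
    ((continuous_restrict H).mul (φ.contDiff.continuous_deriv (by simp))).integrable_of_hasCompactSupport
      (φ.hasCompactSupport.deriv.mul_left)
  change distDeriv (F + G) φ = distDeriv F φ + distDeriv G φ
  simp only [distDeriv_apply, ContinuousMap.add_apply, add_mul]
  rw [integral_add (key F) (key G), neg_add]

theorem distDeriv_smul (c : ℝ) (F : C(EReal, ℝ)) : distDeriv (c • F) = c • distDeriv F := by
  ext φ
  change distDeriv (c • F) φ = c • distDeriv F φ
  simp only [distDeriv_apply, ContinuousMap.smul_apply, smul_eq_mul, mul_assoc]
  rw [integral_const_mul, mul_neg]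

/-- The distributional derivative as a linear map on `B_c`. -/
def derivBc : Bc →ₗ[ℝ] Dist where
  toFun F := distDeriv F
  map_add' F G := distDeriv_add F G
  map_smul' c F := distDeriv_smul c F

/-- For a test function `ψ`, the test function `x ↦ ∫_x^{x+h} ψ`. -/
theorem exists_test (ψ : ℝ → ℝ) (hψ : ContDiff ℝ ∞ ψ) (hs : HasCompactSupport ψ) (h : ℝ) :
    ∃ φ : Test, ∀ x, deriv φ x = ψ (x + h) - ψ x := by
  have hd : ∀ x, HasDerivAt (fun x => ∫ y in (0 : ℝ)..x, ψ y) (ψ x) x := fun x =>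
    intervalIntegral.integral_hasDerivAt_right (hψ.continuous.intervalIntegrable _ _)
      (hψ.continuous.stronglyMeasurableAtFilter _ _) hψ.continuous.continuousAt
  have hP : ContDiff ℝ ∞ (fun x => ∫ y in (0 : ℝ)..x, ψ y) := by
    rw [contDiff_infty_iff_deriv]
    refine ⟨fun x => (hd x).differentiableAt, ?_⟩
    have : deriv (fun x => ∫ y in (0 : ℝ)..x, ψ y) = ψ := funext fun x => (hd x).deriv
    rwa [this]
  obtain ⟨R, hR⟩ := hs.isCompact.isBounded.subset_closedBall (0 : ℝ)
  have hz : ∀ y, R < |y| → ψ y = 0 := fun y hy => by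
    apply image_eq_zero_of_notMem_tsupport
    intro hy'
    have := hR hy'
    simp only [Metric.mem_closedBall, dist_zero_right, Real.norm_eq_abs] at this
    linarith
  let φ : Test :=
    ⟨fun x => (∫ y in (0 : ℝ)..(x + h), ψ y) - ∫ y in (0 : ℝ)..x, ψ y,
      (hP.comp (contDiff_id.add contDiff_const)).sub hP, by
        refine HasCompactSupport.intro (isCompact_closedBall (0 : ℝ) (R + |h|)) fun x hx => ?_
        simp only [Metric.mem_closedBall, dist_zero_right, Real.norm_eq_abs, not_le] at hx
        rw [intervalIntegral.integral_interval_sub_left (hψ.continuous.intervalIntegrable _ _)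
          (hψ.continuous.intervalIntegrable _ _)]
        rw [intervalIntegral.integral_congr (g := fun _ => (0 : ℝ))]
        · simp
        · intro y hy
          apply hz
          have h1 : |y - x| ≤ |h| := by
            have := abs_sub_left_of_mem_uIcc hy
            simpa using this
          have h2 : |x| ≤ |y| + |y - x| := by
            have := abs_sub_abs_le_abs_sub x y
            rw [abs_sub_comm] at this
            linarith
          linarith, by simp⟩
  refine ⟨φ, fun x => ?_⟩
  exact (((hd (x + h)).comp_add_const x h).sub (hd x)).deriv

theorem denseRange_coe_ereal : DenseRange ((↑) : ℝ → EReal) :=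
  dense_of_exists_between fun a b hab => by
    obtain ⟨x, hx⟩ := EReal.lt_iff_exists_real_btwn.1 hab
    exact ⟨x, ⟨x, rfl⟩, hx⟩

/-- Primitives in `B_c` are unique. -/
theorem derivBc_injective : Function.Injective derivBc := by
  rw [← LinearMap.ker_eq_bot, LinearMap.ker_eq_bot']
  rintro ⟨F, hF⟩ h0
  have hF0 : F ⊥ = 0 := hF
  have hc := continuous_restrict F
  have hint : ∀ φ : Test, ∫ x : ℝ, F (x : EReal) * deriv φ x = 0 := fun φ => by
    have h1 : distDeriv F φ = 0 := by
      have : derivBc ⟨F, hF⟩ φ = (0 : Dist) φ := by rw [h0]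
      exact this
    rw [distDeriv_apply] at h1
    linarith
  have hper : ∀ h x : ℝ, F ((x - h : ℝ) : EReal) = F (x : EReal) := by
    intro h
    have hc' : Continuous fun x : ℝ => F ((x - h : ℝ) : EReal) :=
      hc.comp (continuous_id.sub continuous_const)
    have hae := ae_eq_of_integral_contDiff_smul_eq hc'.locallyIntegrable
      hc.locallyIntegrable (fun g hg hgs => by
        obtain ⟨φ, hφ⟩ := exists_test g hg hgs h
        have h1 := hint φ
        simp only [hφ, mul_sub] at h1
        have i1 : Integrable (fun x : ℝ => F (x : EReal) * g x) :=
          (hc.mul hg.continuous).integrable_of_hasCompactSupport hgs.mul_left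
        have i2 : Integrable (fun x : ℝ => F (x : EReal) * g (x + h)) :=
          (hc.mul (hg.continuous.comp (continuous_id.add continuous_const))).integrable_of_hasCompactSupport
            ((hgs.comp_homeomorph (Homeomorph.addRight h)).mul_left)
        rw [integral_sub i2 i1, sub_eq_zero] at h1
        simp only [smul_eq_mul]
        rw [← integral_add_right_eq_self (μ := volume) (fun x : ℝ => g x * F ((x - h : ℝ) : EReal)) h]
        simp only [add_sub_cancel_right]
        simp only [mul_comm (g _)]
        exact h1)
    have := (Continuous.ae_eq_iff_eq volume hc' hc).1 hae
    exact fun x => congrFun this x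
  have hconst : ∀ x : ℝ, F (x : EReal) = F ((0 : ℝ) : EReal) := fun x => by
    have := hper x x
    rw [sub_self] at this
    exact this.symm
  have hE : ∀ z : EReal, F z = F ((0 : ℝ) : EReal) := by
    have : (F : EReal → ℝ) = fun _ => F ((0 : ℝ) : EReal) :=
      denseRange_coe_ereal.equalizer F.continuous continuous_const (funext hconst)
    exact fun z => congrFun this z
  apply Subtype.ext
  ext z
  change F z = 0
  rw [hE z, ← hE ⊥, hF0]

/-- `A_c`: the distributions that are the distributional derivative of some `F ∈ B_c`. -/
def AcSubmodule : Submodule ℝ Dist := LinearMap.range derivBc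

theorem mem_AcSubmodule (f : Dist) : f ∈ AcSubmodule ↔ ∃ F ∈ Bc, f = distDeriv F :=
  ⟨fun ⟨F, hF⟩ => ⟨F, F.2, hF.symm⟩, fun ⟨F, hF, h⟩ => ⟨⟨F, hF⟩, h.symm⟩⟩

/-- `A_c` as a type of its own; it carries the topology of the Alexiewicz norm below (and not the
topology of the space of distributions). -/
def Ac : Type := AcSubmodule

instance : AddCommGroup Ac := inferInstanceAs (AddCommGroup AcSubmodule)

instance : Module ℝ Ac := inferInstanceAs (Module ℝ AcSubmodule)

/-- The inclusion of `A_c` in the space of distributions. -/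
def Ac.toDist : Ac →ₗ[ℝ] Dist := AcSubmodule.subtype

/-- Each `F ∈ B_c` has exactly one derivative in `A_c`, and each `f ∈ A_c` has exactly one primitive
in `B_c`. -/
def primEquiv : Bc ≃ₗ[ℝ] Ac := LinearEquiv.ofInjective derivBc derivBc_injective

theorem primEquiv_toDist (F : Bc) : (primEquiv F).toDist = distDeriv F := rfl

/-- The primitive `F ∈ B_c` of `f ∈ A_c`. -/
def Ac.prim (f : Ac) : C(EReal, ℝ) := (primEquiv.symm f : Bc)

theorem Ac.prim_bot (f : Ac) : f.prim ⊥ = 0 := (primEquiv.symm f).2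

theorem Ac.distDeriv_prim (f : Ac) : distDeriv f.prim = f.toDist := by
  rw [Ac.prim, ← primEquiv_toDist, LinearEquiv.apply_symm_apply]

/-- The continuous primitive integral `∫_a^b f = F(b) - F(a)`, for `a, b ∈ [-∞, ∞]`. -/
def Ac.integral (f : Ac) (a b : EReal) : ℝ := f.prim b - f.prim a

theorem Ac.integral_add (f g : Ac) (a b : EReal) :
    (f + g).integral a b = f.integral a b + g.integral a b := by
  simp only [Ac.integral, Ac.prim, map_add, Submodule.coe_add, ContinuousMap.add_apply]
  ring

theorem Ac.integral_smul (c : ℝ) (f : Ac) (a b : EReal) :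
    (c • f).integral a b = c * f.integral a b := by
  simp only [Ac.integral, Ac.prim, map_smul, Submodule.coe_smul, ContinuousMap.smul_apply,
    smul_eq_mul]
  ring

/-- The Alexiewicz norm `‖f‖ = sup_{x < y} |∫_x^y f|`. -/
instance : Norm Ac where
  norm f := ⨆ p : {p : ℝ × ℝ // p.1 < p.2}, |f.integral p.1.1 p.1.2|

theorem Ac.norm_def (f : Ac) :
    ‖f‖ = ⨆ p : {p : ℝ × ℝ // p.1 < p.2}, |f.integral p.1.1 p.1.2| := rfl

instance : Nonempty {p : ℝ × ℝ // p.1 < p.2} := ⟨⟨(0, 1), zero_lt_one⟩⟩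

theorem Ac.bddAbove (f : Ac) :
    BddAbove (range fun p : {p : ℝ × ℝ // p.1 < p.2} => |f.integral p.1.1 p.1.2|) := by
  refine ⟨‖f.prim‖ + ‖f.prim‖, ?_⟩
  rintro _ ⟨p, rfl⟩
  exact (abs_sub _ _).trans (add_le_add (f.prim.norm_coe_le_norm _) (f.prim.norm_coe_le_norm _))

theorem Ac.core : NormedSpace.Core ℝ Ac where
  norm_nonneg f := Real.iSup_nonneg fun _ => abs_nonneg _
  norm_smul c f := by
    simp only [Ac.norm_def, Ac.integral_smul, abs_mul]
    rw [Real.norm_eq_abs, Real.mul_iSup_of_nonneg (abs_nonneg c)]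
  norm_triangle f g := ciSup_le fun p => by
    rw [Ac.integral_add]
    exact (abs_add_le _ _).trans (add_le_add (le_ciSup f.bddAbove p) (le_ciSup g.bddAbove p))
  norm_eq_zero_iff f := by
    constructor
    · intro h
      have h1 : ∀ x y : ℝ, x < y → f.prim x = f.prim y := fun x y hxy => by
        have h2 : |f.integral x y| ≤ ‖f‖ := le_ciSup f.bddAbove ⟨(x, y), hxy⟩
        rw [h, abs_nonpos_iff, Ac.integral, sub_eq_zero] at h2
        exact h2.symm
      have h2 : ∀ x : ℝ, f.prim x = f.prim ((0 : ℝ) : EReal) := fun x => by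
        rcases lt_trichotomy x 0 with hx | rfl | hx
        · exact h1 _ _ hx
        · rfl
        · exact (h1 _ _ hx).symm
      have hE : (f.prim : EReal → ℝ) = fun _ => f.prim ((0 : ℝ) : EReal) :=
        denseRange_coe_ereal.equalizer f.prim.continuous continuous_const (funext h2)
      have h3 : f.prim = 0 := by
        ext z
        rw [congrFun hE z, ← congrFun hE ⊥, f.prim_bot]
        rfl
      have h4 : primEquiv.symm f = 0 := Subtype.ext h3
      simpa using h4
    · rintro rfl
      have : ∀ a b : EReal, (0 : Ac).integral a b = 0 := fun a b => by
        simp [Ac.integral, Ac.prim]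
      simp [Ac.norm_def, this]

instance : NormedAddCommGroup Ac := NormedAddCommGroup.ofCore Ac.core

instance : NormedSpace ℝ Ac := NormedSpace.ofCore Ac.core

/-! ### Integration against functions of bounded variation -/

/-- The Henstock--Stieltjes integral `∫_{-∞}^{∞} F dg` over `[-∞, ∞]` exists and equals `I`:
for each `ε > 0` there is a gauge `γ` (a neighbourhood of each point of `[-∞, ∞]`) such that all
Riemann--Stieltjes sums over `γ`-fine tagged partitions
`-∞ = a₀ ≤ z₀ ≤ a₁ ≤ z₁ ≤ ⋯ ≤ aₙ = ∞` are within `ε` of `I`. -/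
def HasStieltjesIntegral (F g : EReal → ℝ) (I : ℝ) : Prop :=
  ∀ ε > 0, ∃ γ : EReal → Set EReal, (∀ z, γ z ∈ 𝓝 z) ∧
    ∀ (n : ℕ) (a z : ℕ → EReal), a 0 = ⊥ → a n = ⊤ →
      (∀ i < n, a i ≤ z i ∧ z i ≤ a (i + 1) ∧ Icc (a i) (a (i + 1)) ⊆ γ (z i)) →
      |(∑ i ∈ Finset.range n, F (z i) * (g (a (i + 1)) - g (a i))) - I| < ε

/-- Every gauge on `[-∞, ∞]` has a fine tagged partition. -/
theorem exists_fine_partition (γ : EReal → Set EReal) (hγ : ∀ z, γ z ∈ 𝓝 z) :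
    ∃ (n : ℕ) (a z : ℕ → EReal), a 0 = ⊥ ∧ a n = ⊤ ∧
      ∀ i < n, a i ≤ z i ∧ z i ≤ a (i + 1) ∧ Icc (a i) (a (i + 1)) ⊆ γ (z i) := by
  let P : EReal → Prop := fun b => ∃ (n : ℕ) (a z : ℕ → EReal), a 0 = ⊥ ∧ a n = b ∧
      ∀ i < n, a i ≤ z i ∧ z i ≤ a (i + 1) ∧ Icc (a i) (a (i + 1)) ⊆ γ (z i)
  have hbot : P ⊥ := ⟨0, fun _ => ⊥, fun _ => ⊥, rfl, rfl, by simp⟩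
  have ext : ∀ b s c, P b → b ≤ s → s ≤ c → Icc b c ⊆ γ s → P c := by
    rintro b s c ⟨n, a, z, h0, hn, h⟩ hbs hsc hsub
    refine ⟨n + 1, fun i => if i ≤ n then a i else c, fun i => if i < n then z i else s,
      by simpa using h0, by simp, fun i hi => ?_⟩
    rcases Nat.lt_succ_iff_lt_or_eq.1 hi with hi' | rfl
    · have h1 : i + 1 ≤ n := hi'
      simpa [hi', hi'.le, h1] using h i hi'
    · simp only [le_refl, if_true, lt_irrefl, if_false, Nat.not_succ_le_self, hn]
      exact ⟨hbs, hsc, hsub⟩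
  let s := sSup {b | P b}
  have hle : ∀ b, P b → b ≤ s := fun b hb => le_sSup hb
  obtain ⟨b, hb, hbs, hsub⟩ : ∃ b, P b ∧ b ≤ s ∧ Icc b s ⊆ γ s := by
    rcases eq_or_lt_of_le (bot_le : (⊥ : EReal) ≤ s) with h | h
    · refine ⟨⊥, hbot, bot_le, ?_⟩
      rw [← h, Icc_self, singleton_subset_iff]
      exact mem_of_mem_nhds (hγ ⊥)
    · obtain ⟨l, hl, hls⟩ := exists_Ioc_subset_of_mem_nhds (hγ s) ⟨⊥, h⟩
      obtain ⟨b, hb, hlb⟩ := lt_sSup_iff.1 hl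
      exact ⟨b, hb, hle b hb, fun y hy => hls ⟨hlb.trans_le hy.1, hy.2⟩⟩
  have hs : P s := ext b s s hb hbs le_rfl hsub
  rcases eq_or_lt_of_le (le_top : s ≤ ⊤) with h | h
  · rwa [h] at hs
  · obtain ⟨u, hu, hus⟩ := exists_Ico_subset_of_mem_nhds (hγ s) ⟨⊤, h⟩
    obtain ⟨c, hsc, hcu⟩ := exists_between hu
    have : P c := ext s s c hs le_rfl hsc.le fun y hy => hus ⟨hy.1, hy.2.trans_lt hcu⟩
    exact absurd (hle c this) (not_le.2 hsc)

/-- The value of the Henstock--Stieltjes integral is unique. -/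
theorem HasStieltjesIntegral.unique {F g : EReal → ℝ} {I J : ℝ}
    (hI : HasStieltjesIntegral F g I) (hJ : HasStieltjesIntegral F g J) : I = J := by
  by_contra hne
  have hpos : 0 < |I - J| / 2 := half_pos (abs_pos.2 (sub_ne_zero.2 hne))
  obtain ⟨γ, hγ, h1⟩ := hI _ hpos
  obtain ⟨δ, hδ, h2⟩ := hJ _ hpos
  obtain ⟨n, a, z, h0, hn, h⟩ :=
    exists_fine_partition (fun z => γ z ∩ δ z) fun z => inter_mem (hγ z) (hδ z)
  have e1 := h1 n a z h0 hn fun i hi =>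
    ⟨(h i hi).1, (h i hi).2.1, (h i hi).2.2.trans inter_subset_left⟩
  have e2 := h2 n a z h0 hn fun i hi =>
    ⟨(h i hi).1, (h i hi).2.1, (h i hi).2.2.trans inter_subset_right⟩
  have e3 := abs_sub_le I (∑ i ∈ Finset.range n, F (z i) * (g (a (i + 1)) - g (a i))) J
  rw [abs_sub_comm] at e1
  linarith

/-- The extension of `g : ℝ → ℝ` to `[-∞, ∞]` by its limits `g(±∞)` (which exist when `g` has
bounded variation). -/
def extendByLimits (g : ℝ → ℝ) (z : EReal) : ℝ :=
  if z = ⊥ then limUnder atBot g else if z = ⊤ then limUnder atTop g else g z.toReal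

/-- The integral `∫_{-∞}^{∞} f g` of the distribution `f` times the function `g` exists and equals
`I`: `f` has a primitive `F ∈ B_c`, `g` has bounded variation, and
`I = F(∞) g(∞) - ∫_{-∞}^{∞} F dg`. -/
def HasProdIntegral (f : Dist) (g : ℝ → ℝ) (I : ℝ) : Prop :=
  BoundedVariationOn g univ ∧ ∃ F ∈ Bc, f = distDeriv F ∧ ∃ J : ℝ,
    HasStieltjesIntegral F (extendByLimits g) J ∧ I = F ⊤ * extendByLimits g ⊤ - J

/-- The value of `∫_{-∞}^{∞} f g` is unique. -/
theorem HasProdIntegral.unique {f : Dist} {g : ℝ → ℝ} {I J : ℝ}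
    (hI : HasProdIntegral f g I) (hJ : HasProdIntegral f g J) : I = J := by
  obtain ⟨-, F, hF, hfF, A, hA, rfl⟩ := hI
  obtain ⟨-, G, hG, hfG, B, hB, rfl⟩ := hJ
  have h : (⟨F, hF⟩ : Bc) = ⟨G, hG⟩ := derivBc_injective (hfF.symm.trans hfG)
  obtain rfl : F = G := congrArg Subtype.val h
  rw [hA.unique hB]

open scoped Classical in
/-- The value of `∫_{-∞}^{∞} f g` (zero if the integral does not exist). -/
def prodIntegral (f : Dist) (g : ℝ → ℝ) : ℝ :=
  if h : ∃ I, HasProdIntegral f g I then h.choose else 0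

theorem HasProdIntegral.prodIntegral_eq {f : Dist} {g : ℝ → ℝ} {I : ℝ}
    (h : HasProdIntegral f g I) : prodIntegral f g = I := by
  have h' : ∃ I, HasProdIntegral f g I := ⟨I, h⟩
  rw [prodIntegral, dif_pos h']
  exact h'.choose_spec.unique h

/-! ### The heat kernel and its convolution with `f` -/

/-- The Gauss--Weierstrass heat kernel `Θ_t(x) = (4π|t|)^{-1/2} exp(-x²/(4t))`. -/
def heatKernel (t x : ℝ) : ℝ := Real.exp (-x ^ 2 / (4 * t)) / √(4 * Real.pi * |t|)

/-- `f ∗ Θ_t (x) = ∫_{-∞}^{∞} f(x - ξ) Θ_t(ξ) dξ`. -/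
def heatConv (f : Ac) (x t : ℝ) : ℝ := prodIntegral (reflect x f.toDist) (heatKernel t)

end

end HeatAlex

/-!
Write `F` for the primitive of `f`. The heat kernel and its derivative are integrable and vanish at
`±∞`, so the Stieltjes integral that defines `f ∗ Θ_t` is an ordinary Lebesgue integral: by
`hasStieltjesIntegral_cumul` (with the gauge given by the continuity of `F` on the compact space
`[-∞, ∞]`) one has `∫ F dg = ∫ F g'`, whence `f ∗ Θ_t (x) = ∫ F(y) Θ_t'(x - y) dy` (`heatConv_eq`).
Everything else is a statement about this integral and about its primitive in `x`, which is
`F ∗ Θ_t` (`primConv`).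

*Regularity.* Up to elementary factors in `t`, the two convolutions are Gaussian moments
`G_k(x, a) = ∫ F(y) (x - y) ^ k exp (-a (x - y) ^ 2) dy` at `a = 1 / 4t`. These make sense for
complex `x` and `a` with `0 < re a`, where they satisfy the closed system
`∂_x G_k = k G_{k-1} - 2 a G_{k+1}`, `∂_a G_k = -G_{k+2}` (`hasFDerivAt_gaussMoment`). Hence they
are smooth, holomorphic in each variable, and the heat equation is an identity between moments.

*Estimates.* As `Θ_t'` is odd, `f ∗ Θ_t (x)` is half the integral of `F(x - z) - F(x + z)` against
`Θ_t'`, which is at most `‖f‖ Θ_t(0)`; as `Θ_t` is a probability density, increments of `F ∗ Θ_t`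
are averages of increments of `F`, so that `‖f ∗ Θ_t‖ ≤ ‖f‖`. On boxes of mass one (`rampAc`) the
second bound is attained, and the first is approached as the box shrinks. Convergence to the initial data follows from the uniform continuity of `F` and
the second moment `2 t` of `Θ_t`.

*Failure of integrability.* For the primitive `cos y / (1 + log (1 + |y|))` the weight varies so
slowly that it can be pulled out of the convolution, and as `x → ∞` the function `f ∗ Θ_t (x)` is
`-e^{-t} sin x / (1 + log (1 + |x|))` up to an error that is small relative to the weight. It
therefore lies in no `L^p` with `p < ∞`.
-/

namespace HeatAlex

open MeasureTheory Filter Set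

noncomputable section

/-! ### Complex Gaussian moments -/

theorem integrable_exp_neg_abs : Integrable (fun y : ℝ => Real.exp (-|y|)) := by
  have h1 : IntegrableOn (fun y : ℝ => Real.exp (-|y|)) (Iic 0) :=
    (integrableOn_exp_Iic 0).congr_fun (fun y hy => by
      rw [abs_of_nonpos (mem_Iic.1 hy), neg_neg]) measurableSet_Iic
  have h2 : IntegrableOn (fun y : ℝ => Real.exp (-|y|)) (Ioi 0) :=
    (integrableOn_exp_neg_Ioi 0).congr_fun (fun y hy => by
      simp only [abs_of_pos (mem_Ioi.1 hy)]) measurableSet_Ioi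
  rw [← integrableOn_univ, ← Iic_union_Ioi (a := (0 : ℝ))]
  exact h1.union h2

/-- The functions `w ^ k * exp (-a w ^ 2)` with `w = z - y` are dominated by a multiple of
`exp (-|y|)`, uniformly for `(z, a)` in a neighbourhood of a point with `0 < re a`. -/
theorem exists_gaussian_bound (p₀ : ℂ × ℂ) (h₀ : 0 < p₀.2.re) (k : ℕ) :
    ∃ ε > 0, ∃ C : ℝ, ∀ p ∈ Metric.ball p₀ ε, 0 < p.2.re ∧ ∀ y : ℝ,
      ‖(p.1 - y) ^ k * Complex.exp (-p.2 * (p.1 - y) ^ 2)‖ ≤ C * Real.exp (-|y|) := by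
  -- On the ball below `δ ≤ re a`, `‖a‖ ≤ M` and `‖z‖ ≤ Q`; the exponent, linear terms included, is
  -- then at most `B |y| - δ y ^ 2 / 2 - |y|` plus a constant.
  obtain ⟨δ, hδ⟩ : ∃ δ, δ = p₀.2.re / 2 := ⟨_, rfl⟩
  obtain ⟨M, hM⟩ : ∃ M, M = ‖p₀.2‖ + 1 := ⟨_, rfl⟩
  obtain ⟨Q, hQ⟩ : ∃ Q, Q = ‖p₀.1‖ + 1 := ⟨_, rfl⟩
  obtain ⟨B, hB⟩ : ∃ B, B = 2 * M * Q + 2 := ⟨_, rfl⟩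
  have hδ0 : 0 < δ := by rw [hδ]; linarith
  have hM0 : 0 < M := by rw [hM]; positivity
  have hQ0 : 0 < Q := by rw [hQ]; positivity
  refine ⟨min 1 δ, lt_min one_pos hδ0,
    k.factorial * Real.exp (Q + δ * Q ^ 2 + 3 * M * Q ^ 2 + B ^ 2 / (2 * δ)), fun p hp => ?_⟩
  rw [Metric.mem_ball, dist_eq_norm] at hp
  have h1 : ‖p.1 - p₀.1‖ < min 1 δ := (norm_fst_le (p - p₀)).trans_lt hp
  have h2 : ‖p.2 - p₀.2‖ < min 1 δ := (norm_snd_le (p - p₀)).trans_lt hp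
  have hz : ‖p.1‖ ≤ Q := by
    have := norm_le_norm_add_norm_sub' p.1 p₀.1
    linarith [min_le_left 1 δ]
  have ha : ‖p.2‖ ≤ M := by
    have := norm_le_norm_add_norm_sub' p.2 p₀.2
    linarith [min_le_left 1 δ]
  have hre : δ ≤ p.2.re := by
    have h3 := (Complex.abs_re_le_norm (p.2 - p₀.2)).trans_lt h2
    rw [Complex.sub_re] at h3
    have := (abs_lt.1 (h3.trans_le (min_le_right 1 δ))).1
    linarith
  refine ⟨hδ0.trans_le hre, fun y => ?_⟩
  have hw : ‖p.1 - y‖ ≤ |y| + Q := by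
    have := norm_sub_le p.1 (y : ℂ)
    rw [Complex.norm_real, Real.norm_eq_abs] at this
    linarith
  have hpow : ‖p.1 - y‖ ^ k ≤ k.factorial * Real.exp (|y| + Q) := by
    have h3 := Real.pow_div_factorial_le_exp (|y| + Q) (by positivity) k
    rw [div_le_iff₀ (by positivity)] at h3
    calc _ ≤ (|y| + Q) ^ k := by gcongr
      _ ≤ _ := by linarith
  have hexp : (-p.2 * (p.1 - y) ^ 2).re ≤
      -(δ * y ^ 2 / 2) + δ * Q ^ 2 + 3 * M * Q ^ 2 + 2 * M * Q * |y| := by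
    obtain ⟨⟨zr, zi⟩, ⟨ar, ai⟩⟩ := p
    have e1 : |zr| ≤ Q := (Complex.abs_re_le_norm ⟨zr, zi⟩).trans hz
    have e2 : |zi| ≤ Q := (Complex.abs_im_le_norm ⟨zr, zi⟩).trans hz
    have e3 : |ar| ≤ M := (Complex.abs_re_le_norm ⟨ar, ai⟩).trans ha
    have e4 : |ai| ≤ M := (Complex.abs_im_le_norm ⟨ar, ai⟩).trans ha
    simp only at hre
    have e5 : (-(⟨ar, ai⟩ : ℂ) * ((⟨zr, zi⟩ : ℂ) - y) ^ 2).re =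
        -(ar * (zr - y) ^ 2) + ar * zi ^ 2 + ai * (zi * (2 * (zr - y))) := by
      simp [pow_two]; ring
    rw [e5]
    have f1 : δ * (y ^ 2 / 2 - Q ^ 2) ≤ ar * (zr - y) ^ 2 := by
      calc δ * (y ^ 2 / 2 - Q ^ 2) ≤ δ * (zr - y) ^ 2 := by
            gcongr
            have : zr ^ 2 ≤ Q ^ 2 := sq_le_sq' (by linarith [(abs_le.1 e1).1]) (abs_le.1 e1).2
            nlinarith [sq_nonneg (y - 2 * zr)]
        _ ≤ _ := by gcongr
    have f2 : ar * zi ^ 2 ≤ M * Q ^ 2 := by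
      have : zi ^ 2 ≤ Q ^ 2 := sq_le_sq' (by linarith [(abs_le.1 e2).1]) (abs_le.1 e2).2
      have := (abs_le.1 e3).2
      gcongr
    have f3 : ai * (zi * (2 * (zr - y))) ≤ M * (Q * (2 * (Q + |y|))) := by
      refine (le_abs_self _).trans ?_
      rw [abs_mul, abs_mul, abs_mul, abs_two]
      have := (abs_sub zr y).trans (add_le_add_left e1 _)
      gcongr
    nlinarith
  have hsq : B * |y| ≤ δ * y ^ 2 / 2 + B ^ 2 / (2 * δ) := by
    have : δ * y ^ 2 / 2 + B ^ 2 / (2 * δ) - B * |y| = (δ * |y| - B) ^ 2 / (2 * δ) := by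
      rw [← sq_abs y]; field_simp; ring
    have h4 : 0 ≤ (δ * |y| - B) ^ 2 / (2 * δ) := by positivity
    linarith
  rw [norm_mul, norm_pow, Complex.norm_exp]
  calc _ ≤ (k.factorial * Real.exp (|y| + Q)) * Real.exp (-(δ * y ^ 2 / 2) + δ * Q ^ 2 +
          3 * M * Q ^ 2 + 2 * M * Q * |y|) := by gcongr
    _ = k.factorial * Real.exp ((|y| + Q) + (-(δ * y ^ 2 / 2) + δ * Q ^ 2 +
          3 * M * Q ^ 2 + 2 * M * Q * |y|)) := by rw [Real.exp_add (|y| + Q), mul_assoc]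
    _ ≤ k.factorial * Real.exp ((Q + δ * Q ^ 2 + 3 * M * Q ^ 2 + B ^ 2 / (2 * δ)) + -|y|) := by
        refine mul_le_mul_of_nonneg_left (Real.exp_le_exp.2 ?_) (by positivity)
        have h5 : B * |y| = 2 * M * Q * |y| + 2 * |y| := by rw [hB]; ring
        linarith
    _ = _ := by rw [Real.exp_add _ (-|y|), ← mul_assoc]

/-- The Gaussian moment `∫ F(y) (z - y) ^ k exp (-a (z - y) ^ 2) dy` of `F` at the point
`p = (z, a)`, with complex `z` and `a`. -/
def gaussMoment (F : ℝ → ℝ) (k : ℕ) (p : ℂ × ℂ) : ℂ :=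
  ∫ y : ℝ, (F y : ℂ) * ((p.1 - y) ^ k * Complex.exp (-p.2 * (p.1 - y) ^ 2))

/-- The linear form `(v, w) ↦ A v + B w` on `ℂ × ℂ`. -/
def linForm (A B : ℂ) : ℂ × ℂ →L[ℂ] ℂ :=
  A • ContinuousLinearMap.fst ℂ ℂ ℂ + B • ContinuousLinearMap.snd ℂ ℂ ℂ

theorem linForm_apply (A B : ℂ) (v : ℂ × ℂ) : linForm A B v = A * v.1 + B * v.2 := by
  simp [linForm]

theorem norm_linForm_le (A B : ℂ) : ‖linForm A B‖ ≤ ‖A‖ + ‖B‖ := by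
  refine ContinuousLinearMap.opNorm_le_bound _ (by positivity) fun v => ?_
  rw [linForm_apply, add_mul]
  refine (norm_add_le _ _).trans (add_le_add ?_ ?_) <;> rw [norm_mul] <;> gcongr
  · exact norm_fst_le v
  · exact norm_snd_le v

theorem hasFDerivAt_gaussian (k : ℕ) (y : ℝ) (p : ℂ × ℂ) :
    HasFDerivAt (fun p : ℂ × ℂ => (p.1 - y) ^ k * Complex.exp (-p.2 * (p.1 - y) ^ 2))
      (linForm (k * ((p.1 - y) ^ (k - 1) * Complex.exp (-p.2 * (p.1 - y) ^ 2)) -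
          2 * p.2 * ((p.1 - y) ^ (k + 1) * Complex.exp (-p.2 * (p.1 - y) ^ 2)))
        (-((p.1 - y) ^ (k + 2) * Complex.exp (-p.2 * (p.1 - y) ^ 2)))) p := by
  have h1 : HasFDerivAt (fun p : ℂ × ℂ => p.1 - y) (ContinuousLinearMap.fst ℂ ℂ ℂ) p :=
    hasFDerivAt_fst.sub_const _
  have h2 : HasFDerivAt (fun p : ℂ × ℂ => -p.2) (-ContinuousLinearMap.snd ℂ ℂ ℂ) p :=
    hasFDerivAt_snd.neg
  refine ((h1.pow k).mul ((h2.mul (h1.pow 2)).cexp)).congr_fderiv ?_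
  ext
  · simp [linForm_apply]
    ring
  · simp [linForm_apply]
    ring

section

variable {F : ℝ → ℝ} {M : ℝ}

theorem exists_gaussMoment_bound (hM : ∀ y, |F y| ≤ M) (p₀ : ℂ × ℂ)
    (h₀ : 0 < p₀.2.re) (k : ℕ) :
    ∃ ε > 0, ∃ C : ℝ, ∀ p ∈ Metric.ball p₀ ε, ∀ y : ℝ,
      ‖(F y : ℂ) * ((p.1 - y) ^ k * Complex.exp (-p.2 * (p.1 - y) ^ 2))‖ ≤
        C * Real.exp (-|y|) := by
  obtain ⟨ε, hε, C, hC⟩ := exists_gaussian_bound p₀ h₀ k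
  refine ⟨ε, hε, M * C, fun p hp y => ?_⟩
  rw [norm_mul, Complex.norm_real, mul_assoc]
  exact mul_le_mul (hM y) ((hC p hp).2 y) (norm_nonneg _) ((abs_nonneg _).trans (hM y))

theorem continuous_gaussMoment_integrand (hF : Continuous F) (k : ℕ) (p : ℂ × ℂ) :
    Continuous fun y : ℝ => (F y : ℂ) * ((p.1 - y) ^ k * Complex.exp (-p.2 * (p.1 - y) ^ 2)) := by
  fun_prop

theorem integrable_gaussMoment (hF : Continuous F) (hM : ∀ y, |F y| ≤ M) (k : ℕ) (p : ℂ × ℂ)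
    (hp : 0 < p.2.re) :
    Integrable fun y : ℝ => (F y : ℂ) * ((p.1 - y) ^ k * Complex.exp (-p.2 * (p.1 - y) ^ 2)) := by
  obtain ⟨ε, hε, C, hC⟩ := exists_gaussMoment_bound hM p hp k
  exact (integrable_exp_neg_abs.const_mul C).mono'
    (continuous_gaussMoment_integrand hF k p).aestronglyMeasurable
    (ae_of_all _ (hC p (Metric.mem_ball_self hε)))

theorem hasFDerivAt_gaussMoment (hF : Continuous F) (hM : ∀ y, |F y| ≤ M) (k : ℕ) (p : ℂ × ℂ)
    (hp : 0 < p.2.re) :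
    HasFDerivAt (gaussMoment F k)
      (linForm (k * gaussMoment F (k - 1) p - 2 * p.2 * gaussMoment F (k + 1) p)
        (-gaussMoment F (k + 2) p)) p := by
  obtain ⟨ε₁, hε₁, C₁, hC₁⟩ := exists_gaussMoment_bound hM p hp (k - 1)
  obtain ⟨ε₂, hε₂, C₂, hC₂⟩ := exists_gaussMoment_bound hM p hp (k + 1)
  obtain ⟨ε₃, hε₃, C₃, hC₃⟩ := exists_gaussMoment_bound hM p hp (k + 2)
  obtain ⟨ε, hε⟩ : ∃ ε, ε = min (min ε₁ ε₂) (min ε₃ 1) := ⟨_, rfl⟩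
  have hε0 : 0 < ε := by rw [hε]; positivity
  have hle₁ : ε ≤ ε₁ := hε.trans_le ((min_le_left _ _).trans (min_le_left _ _))
  have hle₂ : ε ≤ ε₂ := hε.trans_le ((min_le_left _ _).trans (min_le_right _ _))
  have hle₃ : ε ≤ ε₃ := hε.trans_le ((min_le_right _ _).trans (min_le_left _ _))
  have hle₄ : ε ≤ 1 := hε.trans_le ((min_le_right _ _).trans (min_le_right _ _))
  -- `E j q y` is the integrand of the `j`-th moment, `D q y` the derivative of `E k q y` in `q`.
  let E : ℕ → ℂ × ℂ → ℝ → ℂ := fun k q y =>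
    (F y : ℂ) * ((q.1 - y) ^ k * Complex.exp (-q.2 * (q.1 - y) ^ 2))
  have hEi : ∀ k, Integrable (E k p) := fun k => integrable_gaussMoment hF hM k p hp
  let D : ℂ × ℂ → ℝ → (ℂ × ℂ →L[ℂ] ℂ) := fun q y =>
    linForm (k * E (k - 1) q y - 2 * q.2 * E (k + 1) q y) (-E (k + 2) q y)
  have hi1 : Integrable fun y => k * E (k - 1) p y - 2 * p.2 * E (k + 1) p y :=
    ((hEi _).const_mul _).sub ((hEi _).const_mul _)
  have hi2 : Integrable fun y => (k * E (k - 1) p y - 2 * p.2 * E (k + 1) p y) •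
      ContinuousLinearMap.fst ℂ ℂ ℂ := hi1.smul_const _
  have hi3 : Integrable fun y => (-E (k + 2) p y) • ContinuousLinearMap.snd ℂ ℂ ℂ :=
    (hEi _).neg.smul_const _
  have hDint : ∫ y, D p y = linForm
      (k * gaussMoment F (k - 1) p - 2 * p.2 * gaussMoment F (k + 1) p)
      (-gaussMoment F (k + 2) p) := by
    refine (integral_add hi2 hi3).trans ?_
    rw [integral_smul_const, integral_smul_const, integral_sub ((hEi _).const_mul _)
      ((hEi _).const_mul _), integral_const_mul, integral_const_mul, integral_neg]
    rfl
  rw [← hDint]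
  refine hasFDerivAt_integral_of_dominated_of_fderiv_le (𝕜 := ℂ) (F := E k) (F' := D)
    (bound := fun y => (k * C₁ + 2 * (‖p.2‖ + 1) * C₂ + C₃) * Real.exp (-|y|))
    (Metric.ball_mem_nhds p hε0)
    (Eventually.of_forall fun q => (continuous_gaussMoment_integrand hF k q).aestronglyMeasurable)
    (hEi k) ?_ (ae_of_all _ fun y q hq => ?_) (integrable_exp_neg_abs.const_mul _)
    (ae_of_all _ fun y q _ => ?_)
  · exact hi2.aestronglyMeasurable.add hi3.aestronglyMeasurable
  · have b1 := hC₁ q (Metric.ball_subset_ball hle₁ hq) y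
    have b2 := hC₂ q (Metric.ball_subset_ball hle₂ hq) y
    have b3 := hC₃ q (Metric.ball_subset_ball hle₃ hq) y
    have b4 : ‖q.2‖ ≤ ‖p.2‖ + 1 := by
      rw [Metric.mem_ball, dist_eq_norm] at hq
      have h5 := norm_le_norm_add_norm_sub' q.2 p.2
      have h6 := norm_snd_le (q - p)
      rw [Prod.snd_sub] at h6
      linarith
    calc ‖D q y‖ ≤ ‖(k : ℂ) * E (k - 1) q y - 2 * q.2 * E (k + 1) q y‖ +
          ‖-E (k + 2) q y‖ := norm_linForm_le _ _
      _ ≤ (k * (C₁ * Real.exp (-|y|)) + 2 * (‖p.2‖ + 1) * (C₂ * Real.exp (-|y|))) +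
          C₃ * Real.exp (-|y|) := by
          rw [norm_neg]
          refine add_le_add ((norm_sub_le _ _).trans (add_le_add ?_ ?_)) b3
          · rw [norm_mul, Complex.norm_natCast]
            gcongr
          · rw [norm_mul, norm_mul, Complex.norm_two]
            gcongr
      _ = _ := by ring
  · refine ((hasFDerivAt_gaussian k y q).const_mul (F y : ℂ)).congr_fderiv ?_
    ext
    · simp [D, E, linForm_apply]
      ring
    · simp [D, E, linForm_apply]

theorem isOpen_re_snd_pos : IsOpen {p : ℂ × ℂ | 0 < p.2.re} :=
  isOpen_lt continuous_const (Complex.continuous_re.comp continuous_snd)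

theorem contDiffOn_gaussMoment (hF : Continuous F) (hM : ∀ y, |F y| ≤ M) (k : ℕ) :
    ContDiffOn ℂ ∞ (gaussMoment F k) {p : ℂ × ℂ | 0 < p.2.re} := by
  rw [contDiffOn_infty]
  intro n
  induction n generalizing k with
  | zero =>
    exact contDiffOn_zero.2 fun p hp =>
      (hasFDerivAt_gaussMoment hF hM k p hp).continuousAt.continuousWithinAt
  | succ n ih =>
    rw [Nat.cast_add_one]
    refine (contDiffOn_succ_iff_fderiv_of_isOpen isOpen_re_snd_pos).2 ⟨fun p hp =>
      (hasFDerivAt_gaussMoment hF hM k p hp).differentiableAt.differentiableWithinAt,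
      fun h => absurd h (WithTop.coe_ne_top (a := (n : ℕ∞))), ?_⟩
    refine ContDiffOn.congr ?_ fun p hp => (hasFDerivAt_gaussMoment hF hM k p hp).fderiv
    exact (((contDiffOn_const.mul (ih _)).sub
      ((contDiffOn_const.mul contDiff_snd.contDiffOn).mul (ih _))).smul contDiffOn_const).add
      ((ih _).neg.smul contDiffOn_const)

/-- The Gaussian moments at real points `(x, a)`. -/
def realMoment (F : ℝ → ℝ) (k : ℕ) (x a : ℝ) : ℝ :=
  ∫ y : ℝ, F y * ((x - y) ^ k * Real.exp (-a * (x - y) ^ 2))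

theorem gaussMoment_ofReal (k : ℕ) (x a : ℝ) :
    gaussMoment F k (x, a) = (realMoment F k x a : ℂ) := by
  rw [realMoment, ← integral_complex_ofReal, gaussMoment]
  push_cast
  rfl

theorem realMoment_eq_re (k : ℕ) (x a : ℝ) :
    realMoment F k x a = (gaussMoment F k (x, a)).re := by
  rw [gaussMoment_ofReal, Complex.ofReal_re]

theorem contDiffOn_realMoment (hF : Continuous F) (hM : ∀ y, |F y| ≤ M) (k : ℕ) :
    ContDiffOn ℝ ∞ (fun p : ℝ × ℝ => realMoment F k p.1 p.2) {p | 0 < p.2} := by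
  simp only [realMoment_eq_re]
  have h := (contDiffOn_gaussMoment hF hM k).restrict_scalars ℝ
  have h2 : ContDiff ℝ ∞ fun p : ℝ × ℝ => ((p.1 : ℂ), (p.2 : ℂ)) :=
    (Complex.ofRealCLM.contDiff.comp contDiff_fst).prodMk
      (Complex.ofRealCLM.contDiff.comp contDiff_snd)
  exact Complex.reCLM.contDiff.comp_contDiffOn (h.comp h2.contDiffOn fun p hp => by simpa using hp)

theorem hasDerivAt_realMoment_fst (hF : Continuous F) (hM : ∀ y, |F y| ≤ M) (k : ℕ) (x : ℝ)
    {a : ℝ} (ha : 0 < a) :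
    HasDerivAt (fun x => realMoment F k x a)
      (k * realMoment F (k - 1) x a - 2 * a * realMoment F (k + 1) x a) x := by
  simp only [realMoment_eq_re]
  have h := (hasFDerivAt_gaussMoment hF hM k (x, a) (by simpa using ha)).comp_hasDerivAt (x : ℂ)
    ((hasDerivAt_id (x : ℂ)).prodMk (hasDerivAt_const _ (a : ℂ)))
  refine h.real_of_complex.congr_deriv ?_
  simp [gaussMoment_ofReal, linForm_apply]

theorem hasDerivAt_realMoment_snd (hF : Continuous F) (hM : ∀ y, |F y| ≤ M) (k : ℕ) (x : ℝ)
    {a : ℝ} (ha : 0 < a) :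
    HasDerivAt (fun a => realMoment F k x a) (-realMoment F (k + 2) x a) a := by
  simp only [realMoment_eq_re]
  have h := (hasFDerivAt_gaussMoment hF hM k (x, a) (by simpa using ha)).comp_hasDerivAt (a : ℂ)
    ((hasDerivAt_const _ (x : ℂ)).prodMk (hasDerivAt_id (a : ℂ)))
  refine h.real_of_complex.congr_deriv ?_
  simp [gaussMoment_ofReal, linForm_apply]

theorem analyticAt_realMoment_fst (hF : Continuous F) (hM : ∀ y, |F y| ≤ M) (k : ℕ) (x : ℝ)
    {a : ℝ} (ha : 0 < a) : AnalyticAt ℝ (fun x => realMoment F k x a) x := by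
  simp only [realMoment_eq_re]
  have h : Differentiable ℂ fun z : ℂ => gaussMoment F k (z, a) := fun z => by
    exact ((hasFDerivAt_gaussMoment hF hM k (z, a) (by simpa using ha)).comp_hasDerivAt z
      ((hasDerivAt_id z).prodMk (hasDerivAt_const _ (a : ℂ)))).differentiableAt
  exact (h.analyticAt x).re_ofReal

theorem analyticAt_realMoment_snd (hF : Continuous F) (hM : ∀ y, |F y| ≤ M) (k : ℕ) (x : ℝ)
    {a : ℝ} (ha : 0 < a) : AnalyticAt ℝ (fun a => realMoment F k x a) a := by
  simp only [realMoment_eq_re]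
  have h : DifferentiableOn ℂ (fun z : ℂ => gaussMoment F k (x, z)) {z | 0 < z.re} := fun z hz => by
    exact ((hasFDerivAt_gaussMoment hF hM k (x, z) hz).comp_hasDerivAt z ((hasDerivAt_const _
      (x : ℂ)).prodMk (hasDerivAt_id z))).differentiableAt.differentiableWithinAt
  have ho : IsOpen {z : ℂ | 0 < z.re} := isOpen_lt continuous_const Complex.continuous_re
  exact (h.analyticAt (ho.mem_nhds (by simpa using ha))).re_ofReal

end

/-! ### Stieltjes integrals against differentiable integrators -/

/-- The indefinite integral `∫_{-∞}^z h`, for `z ∈ [-∞, ∞]`. -/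
def cumul (h : ℝ → ℝ) (z : EReal) : ℝ := ∫ x in {x : ℝ | (x : EReal) ≤ z}, h x

theorem measurableSet_coe_le (z : EReal) : MeasurableSet {x : ℝ | (x : EReal) ≤ z} :=
  measurableSet_le measurable_coe_real_ereal measurable_const

theorem cumul_bot (h : ℝ → ℝ) : cumul h ⊥ = 0 := by simp [cumul]

theorem cumul_top (h : ℝ → ℝ) : cumul h ⊤ = ∫ x, h x := by simp [cumul]

theorem cumul_coe (h : ℝ → ℝ) (z : ℝ) : cumul h z = ∫ x in Iic z, h x := by
  simp only [cumul, EReal.coe_le_coe_iff]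
  rfl

theorem cumul_sub {h : ℝ → ℝ} (hi : Integrable h) {a b : EReal} (hab : a ≤ b) :
    cumul h b - cumul h a =
      ∫ x in {x : ℝ | (x : EReal) ≤ b} \ {x : ℝ | (x : EReal) ≤ a}, h x := by
  have hsub : {x : ℝ | (x : EReal) ≤ a} ⊆ {x : ℝ | (x : EReal) ≤ b} :=
    fun x hx => le_trans hx hab
  rw [setIntegral_sdiff (measurableSet_coe_le a) hi.integrableOn hsub]
  rfl

theorem cumul_abs_sub_nonneg {h : ℝ → ℝ} (hi : Integrable h) {a b : EReal} (hab : a ≤ b) :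
    0 ≤ cumul (fun x => |h x|) b - cumul (fun x => |h x|) a := by
  rw [cumul_sub hi.abs hab]
  exact integral_nonneg fun x => abs_nonneg _

theorem abs_cumul_sub_le {h : ℝ → ℝ} (hi : Integrable h) {a b : EReal} (hab : a ≤ b) :
    |cumul h b - cumul h a| ≤ cumul (fun x => |h x|) b - cumul (fun x => |h x|) a := by
  rw [cumul_sub hi hab, cumul_sub hi.abs hab]
  exact abs_integral_le_integral_abs

section

variable {g g' : ℝ → ℝ}

theorem extendByLimits_eq_cumul (hg : ∀ x, HasDerivAt g (g' x) x) (hi : Integrable g')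
    (hbot : Tendsto g atBot (𝓝 0)) (htop : Tendsto g atTop (𝓝 0)) (z : EReal) :
    extendByLimits g z = cumul g' z := by
  induction z with
  | bot => simp [extendByLimits, cumul_bot, hbot.limUnder_eq]
  | top =>
    simp [extendByLimits, cumul_top, htop.limUnder_eq,
      integral_of_hasDerivAt_of_tendsto hg hi hbot htop]
  | coe x =>
    rw [cumul_coe, integral_Iic_of_hasDerivAt_of_tendsto' (fun x _ => hg x) hi.integrableOn hbot]
    simp [extendByLimits]

theorem boundedVariationOn_of_integrable_deriv (hg : ∀ x, HasDerivAt g (g' x) x)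
    (hi : Integrable g') (hbot : Tendsto g atBot (𝓝 0)) : BoundedVariationOn g univ := by
  have hgc : ∀ x : ℝ, g x = cumul g' x := fun x => by
    rw [cumul_coe, integral_Iic_of_hasDerivAt_of_tendsto' (fun x _ => hg x) hi.integrableOn hbot,
      sub_zero]
  refine ne_top_of_le_ne_top (b := ENNReal.ofReal (∫ x, |g' x|)) ENNReal.ofReal_ne_top
    (iSup_le fun p => ?_)
  obtain ⟨n, u, hu, -⟩ := p
  calc ∑ i ∈ Finset.range n, edist (g (u (i + 1))) (g (u i))
      ≤ ∑ i ∈ Finset.range n, ENNReal.ofReal (cumul (fun x => |g' x|) (u (i + 1) : ℝ) -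
          cumul (fun x => |g' x|) (u i : ℝ)) := by
        refine Finset.sum_le_sum fun i _ => ?_
        rw [edist_dist, Real.dist_eq, hgc, hgc]
        exact ENNReal.ofReal_le_ofReal
          (abs_cumul_sub_le hi (EReal.coe_le_coe_iff.2 (hu i.le_succ)))
    _ = ENNReal.ofReal (cumul (fun x => |g' x|) (u n : ℝ) - cumul (fun x => |g' x|) (u 0 : ℝ)) := by
        rw [← ENNReal.ofReal_sum_of_nonneg fun i _ =>
          cumul_abs_sub_nonneg hi (EReal.coe_le_coe_iff.2 (hu i.le_succ)),
          Finset.sum_range_sub fun i => cumul (fun x => |g' x|) (u i : ℝ)]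
    _ ≤ _ := by
        refine ENNReal.ofReal_le_ofReal ?_
        have h1 := cumul_abs_sub_nonneg hi (le_top : ((u n : ℝ) : EReal) ≤ ⊤)
        have h2 := cumul_abs_sub_nonneg hi (bot_le : ⊥ ≤ ((u 0 : ℝ) : EReal))
        rw [cumul_top] at h1
        rw [cumul_bot] at h2
        linarith

theorem integrable_mul_of_integrable (F : C(EReal, ℝ)) (hi : Integrable g') :
    Integrable fun x : ℝ => F x * g' x :=
  hi.bdd_mul (continuous_restrict F).aestronglyMeasurable (c := ‖F‖)
    (ae_of_all _ fun x => F.norm_coe_le_norm x)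

/-- The gauge is `γ(z) = {w | |F w - F z| < η}`: over a piece of a fine partition the
Stieltjes summand differs from `∫ F g'` by at most `η ∫ |g'|`. -/
theorem hasStieltjesIntegral_cumul (F : C(EReal, ℝ)) (hi : Integrable g') :
    HasStieltjesIntegral F (cumul g') (∫ x : ℝ, F x * g' x) := by
  intro ε hε
  have hI : 0 ≤ ∫ x, |g' x| := integral_nonneg fun x => abs_nonneg _
  obtain ⟨η, hη⟩ : ∃ η, η = ε / ((∫ x, |g' x|) + 1) := ⟨_, rfl⟩
  have hη0 : 0 < η := by rw [hη]; positivity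
  have hFi := integrable_mul_of_integrable F hi
  refine ⟨fun z => {w | |F w - F z| < η}, fun z => ?_, fun n a z h0 hn h => ?_⟩
  · have := (Metric.tendsto_nhds.1 (F.continuous.tendsto z)) η hη0
    simp only [Real.dist_eq] at this
    exact this
  have key : ∀ i ∈ Finset.range n,
      |F (z i) * (cumul g' (a (i + 1)) - cumul g' (a i)) -
        (cumul (fun x : ℝ => F x * g' x) (a (i + 1)) - cumul (fun x : ℝ => F x * g' x) (a i))| ≤
      η * (cumul (fun x => |g' x|) (a (i + 1)) - cumul (fun x => |g' x|) (a i)) := by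
    intro i hin
    obtain ⟨h1, h2, h3⟩ := h i (Finset.mem_range.1 hin)
    have hle := h1.trans h2
    rw [cumul_sub hi hle, cumul_sub hFi hle, cumul_sub hi.abs hle, ← integral_const_mul,
      ← integral_const_mul, ← integral_sub (hi.const_mul _).integrableOn hFi.integrableOn]
    rw [← Real.norm_eq_abs]
    refine norm_integral_le_of_norm_le (hi.abs.const_mul _).integrableOn ?_
    refine (ae_restrict_iff' ((measurableSet_coe_le _).diff (measurableSet_coe_le _))).2
      (ae_of_all _ fun x hx => ?_)
    have hx' : |F x - F (z i)| < η := h3 ⟨(not_le.1 hx.2).le, hx.1⟩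
    rw [← sub_mul, norm_mul, Real.norm_eq_abs, Real.norm_eq_abs, abs_sub_comm]
    gcongr
  have e1 : ∑ i ∈ Finset.range n, (cumul (fun x : ℝ => F x * g' x) (a (i + 1)) -
      cumul (fun x : ℝ => F x * g' x) (a i)) = ∫ x : ℝ, F x * g' x := by
    rw [Finset.sum_range_sub fun i => cumul (fun x : ℝ => F x * g' x) (a i), h0, hn, cumul_top,
      cumul_bot, sub_zero]
  have e2 : ∑ i ∈ Finset.range n, (cumul (fun x => |g' x|) (a (i + 1)) -
      cumul (fun x => |g' x|) (a i)) = ∫ x, |g' x| := by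
    rw [Finset.sum_range_sub fun i => cumul (fun x => |g' x|) (a i), h0, hn, cumul_top,
      cumul_bot, sub_zero]
  rw [← e1, ← Finset.sum_sub_distrib]
  calc _ ≤ _ := Finset.abs_sum_le_sum_abs _ _
    _ ≤ _ := Finset.sum_le_sum key
    _ = η * ∫ x, |g' x| := by rw [← Finset.mul_sum, e2]
    _ < η * ((∫ x, |g' x|) + 1) := by gcongr; linarith
    _ = ε := by rw [hη]; field_simp

theorem hasProdIntegral_distDeriv {F : C(EReal, ℝ)} (hF : F ∈ Bc)
    (hg : ∀ x, HasDerivAt g (g' x) x) (hi : Integrable g')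
    (hbot : Tendsto g atBot (𝓝 0)) (htop : Tendsto g atTop (𝓝 0)) :
    HasProdIntegral (distDeriv F) g (-∫ x : ℝ, F x * g' x) := by
  have he : extendByLimits g = cumul g' :=
    funext (extendByLimits_eq_cumul hg hi hbot htop)
  refine ⟨boundedVariationOn_of_integrable_deriv hg hi hbot, F, hF, rfl,
    ∫ x : ℝ, F x * g' x, ?_, ?_⟩
  · rw [he]
    exact hasStieltjesIntegral_cumul F hi
  · rw [he, cumul_top, integral_of_hasDerivAt_of_tendsto hg hi hbot htop]
    simp

end

/-! ### Reflection of a primitive -/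

theorem continuous_coe_sub (x : ℝ) : Continuous fun z : EReal => (x : EReal) - z := by
  rw [continuous_iff_continuousAt]
  intro z
  have h1 : ContinuousAt (fun p : EReal × EReal => p.1 + p.2) ((x : EReal), -z) :=
    EReal.continuousAt_add (Or.inl (EReal.coe_ne_top x)) (Or.inl (EReal.coe_ne_bot x))
  have h2 : ContinuousAt (fun z : EReal => ((x : EReal), -z)) z :=
    (continuous_const.prodMk continuous_neg).continuousAt
  exact ContinuousAt.comp (f := fun z : EReal => ((x : EReal), -z)) h1 h2

/-- The primitive `z ↦ F(∞) - F(x - z)` of the reflected distribution `F'(x - ·)`. -/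
def reflPrim (x : ℝ) (F : C(EReal, ℝ)) : C(EReal, ℝ) where
  toFun z := F ⊤ - F (x - z)
  continuous_toFun := continuous_const.sub (F.continuous.comp (continuous_coe_sub x))

theorem reflPrim_coe (x : ℝ) (F : C(EReal, ℝ)) (y : ℝ) :
    reflPrim x F y = F ⊤ - F ((x - y : ℝ) : EReal) := by
  rw [EReal.coe_sub]
  rfl

theorem reflPrim_mem (x : ℝ) (F : C(EReal, ℝ)) : reflPrim x F ∈ Bc := by
  change F ⊤ - F (x - ⊥) = 0
  simp

theorem integral_deriv_test (φ : Test) : ∫ x, deriv φ x = 0 := by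
  have hd : ∀ x, HasDerivAt φ (deriv φ x) x := fun x =>
    (φ.contDiff.differentiable (by simp) x).hasDerivAt
  have hi : Integrable (deriv φ) :=
    (φ.contDiff.continuous_deriv (by simp)).integrable_of_hasCompactSupport
      φ.hasCompactSupport.deriv
  have hz : Tendsto φ (cocompact ℝ) (𝓝 0) := φ.hasCompactSupport.is_zero_at_infty
  rw [integral_of_hasDerivAt_of_tendsto hd hi (hz.mono_left atBot_le_cocompact)
    (hz.mono_left atTop_le_cocompact), sub_zero]

theorem reflect_distDeriv (x : ℝ) (F : C(EReal, ℝ)) :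
    reflect x (distDeriv F) = distDeriv (reflPrim x F) := by
  ext φ
  change distDeriv F (reflTest x φ) = _
  have hi : Integrable (deriv φ) :=
    (φ.contDiff.continuous_deriv (by simp)).integrable_of_hasCompactSupport
      φ.hasCompactSupport.deriv
  have hd : ∀ y, deriv (reflTest x φ) y = -deriv φ (x - y) := fun y => by
    have h1 : (reflTest x φ : ℝ → ℝ) = fun y => φ (x - y) := rfl
    rw [h1, deriv_comp_const_sub]
  have hs : Integrable fun y : ℝ => F ((x - y : ℝ) : EReal) * deriv φ y :=
    hi.bdd_mul ((continuous_restrict F).comp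
      (continuous_const.sub continuous_id)).aestronglyMeasurable (c := ‖F‖)
      (ae_of_all _ fun y => F.norm_coe_le_norm _)
  rw [distDeriv_apply, distDeriv_apply]
  simp only [hd, reflPrim_coe, sub_mul]
  rw [integral_sub (hi.const_mul _) hs, integral_const_mul, integral_deriv_test,
    ← integral_sub_left_eq_self (fun y : ℝ => F (y : EReal) * -deriv φ (x - y)) volume x]
  simp [integral_neg]

/-! ### The heat kernel -/

/-- The derivative `-(x / 2t) Θ_t(x)` of the heat kernel. -/
def heatKernelDeriv (t x : ℝ) : ℝ := -(x / (2 * t)) * heatKernel t x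

theorem heatKernel_neg (t x : ℝ) : heatKernel t (-x) = heatKernel t x := by
  simp [heatKernel]

theorem heatKernelDeriv_neg (t x : ℝ) : heatKernelDeriv t (-x) = -heatKernelDeriv t x := by
  simp only [heatKernelDeriv, heatKernel_neg]; ring

theorem heatKernel_nonneg (t x : ℝ) : 0 ≤ heatKernel t x := by
  unfold heatKernel; positivity

theorem heatKernel_zero {t : ℝ} (ht : 0 < t) : heatKernel t 0 = 1 / (2 * √(Real.pi * t)) := by
  rw [heatKernel, abs_of_pos ht, mul_assoc, Real.sqrt_mul (by norm_num),
    show (4 : ℝ) = 2 ^ 2 by norm_num, Real.sqrt_sq (by norm_num)]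
  simp

theorem hasDerivAt_heatKernel (t x : ℝ) :
    HasDerivAt (heatKernel t) (heatKernelDeriv t x) x := by
  have h := ((((hasDerivAt_id x).pow 2).neg.div_const (4 * t)).exp).div_const
    (√(4 * Real.pi * |t|))
  refine h.congr_deriv ?_
  simp only [heatKernelDeriv, heatKernel, id, Pi.neg_apply, Pi.pow_apply]
  ring

theorem deriv_heatKernel (t : ℝ) : deriv (heatKernel t) = heatKernelDeriv t :=
  funext fun x => (hasDerivAt_heatKernel t x).deriv

theorem continuous_heatKernel (t : ℝ) : Continuous (heatKernel t) :=
  continuous_iff_continuousAt.2 fun x => (hasDerivAt_heatKernel t x).continuousAt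

theorem continuous_heatKernelDeriv (t : ℝ) : Continuous (heatKernelDeriv t) :=
  ((continuous_id.div_const _).neg).mul (continuous_heatKernel t)

theorem heatKernel_eq_gaussianPDFReal {t : ℝ} (ht : 0 < t) :
    heatKernel t = ProbabilityTheory.gaussianPDFReal 0 (2 * t).toNNReal := by
  ext x
  rw [heatKernel, ProbabilityTheory.gaussianPDFReal, abs_of_pos ht,
    Real.coe_toNNReal _ (by positivity), div_eq_inv_mul]
  ring_nf

theorem toNNReal_two_mul_ne_zero {t : ℝ} (ht : 0 < t) : (2 * t).toNNReal ≠ 0 := by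
  simpa using ht

section

variable {t : ℝ}

theorem integrable_heatKernel (ht : 0 < t) : Integrable (heatKernel t) := by
  rw [heatKernel_eq_gaussianPDFReal ht]
  exact ProbabilityTheory.integrable_gaussianPDFReal _ _

theorem integral_heatKernel (ht : 0 < t) : ∫ x, heatKernel t x = 1 := by
  rw [heatKernel_eq_gaussianPDFReal ht]
  exact ProbabilityTheory.integral_gaussianPDFReal_eq_one _ (toNNReal_two_mul_ne_zero ht)

theorem integral_mul_heatKernel (ht : 0 < t) (h : ℝ → ℝ) :
    ∫ x, h x * heatKernel t x = ∫ x, h x ∂ProbabilityTheory.gaussianReal 0 (2 * t).toNNReal := by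
  rw [ProbabilityTheory.integral_gaussianReal_eq_integral_smul (toNNReal_two_mul_ne_zero ht),
    ← heatKernel_eq_gaussianPDFReal ht]
  simp [mul_comm]

theorem integral_sq_mul_heatKernel (ht : 0 < t) : ∫ x, x ^ 2 * heatKernel t x = 2 * t := by
  rw [integral_mul_heatKernel ht]
  have h := ProbabilityTheory.variance_id_gaussianReal (μ := 0) (v := (2 * t).toNNReal)
  rw [ProbabilityTheory.variance_of_integral_eq_zero aemeasurable_id (by simp)] at h
  rw [Real.coe_toNNReal _ (by positivity)] at h
  exact h

theorem integral_cos_mul_heatKernel (ht : 0 < t) :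
    ∫ x, Real.cos x * heatKernel t x = Real.exp (-t) := by
  rw [integral_mul_heatKernel ht]
  have h := ProbabilityTheory.charFun_gaussianReal (μ := 0) (v := (2 * t).toNNReal) 1
  rw [charFun_apply_real] at h
  have h2 := congrArg Complex.re h
  rw [← RCLike.re_eq_complex_re, ← integral_re] at h2
  · have e : (((2 * t).toNNReal : ℝ) : ℂ) = 2 * t := by
      rw [Real.coe_toNNReal _ (by positivity)]; push_cast; rfl
    simp only [e] at h2
    simp [Complex.exp_ofReal_mul_I_re] at h2
    rw [h2, ← Complex.ofReal_neg, Complex.exp_ofReal_re]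
  · refine Integrable.of_bound (C := 1) (by fun_prop) (ae_of_all _ fun x => ?_)
    simp [Complex.norm_exp]

theorem integrable_sq_mul_heatKernel (ht : 0 < t) :
    Integrable fun x => x ^ 2 * heatKernel t x := by
  by_contra h
  have h2 := integral_sq_mul_heatKernel ht
  rw [integral_undef h] at h2
  linarith

theorem integrable_heatKernelDeriv (ht : 0 < t) : Integrable (heatKernelDeriv t) := by
  refine (((integrable_heatKernel ht).add (integrable_sq_mul_heatKernel ht)).const_mul
    (1 / (2 * t))).mono' (continuous_heatKernelDeriv t).aestronglyMeasurable
    (ae_of_all _ fun x => ?_)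
  have h0 := heatKernel_nonneg t x
  rw [heatKernelDeriv, norm_mul, norm_neg, norm_div, Real.norm_eq_abs, Real.norm_eq_abs,
    Real.norm_eq_abs, abs_of_pos (by positivity : 0 < 2 * t), abs_of_nonneg h0]
  have h1 : |x| ≤ 1 + x ^ 2 := abs_le.2 ⟨by nlinarith, by nlinarith⟩
  calc |x| / (2 * t) * heatKernel t x ≤ (1 + x ^ 2) / (2 * t) * heatKernel t x := by gcongr
    _ = _ := by simp only [Pi.add_apply]; ring

theorem integrable_abs_mul_heatKernelDeriv (ht : 0 < t) :
    Integrable fun x => |x| * |heatKernelDeriv t x| := by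
  refine ((integrable_sq_mul_heatKernel ht).const_mul (1 / (2 * t))).congr
    (ae_of_all _ fun x => ?_)
  simp only [heatKernelDeriv, abs_mul, abs_neg, abs_div, abs_of_nonneg (heatKernel_nonneg t x),
    abs_of_pos (by positivity : 0 < 2 * t)]
  rw [← sq_abs x]
  ring

theorem tendsto_heatKernel_atTop (ht : 0 < t) : Tendsto (heatKernel t) atTop (𝓝 0) := by
  have h1 : Tendsto (fun x : ℝ => -x ^ 2 / (4 * t)) atTop atBot := by
    simp only [neg_div]
    exact tendsto_neg_atTop_atBot.comp
      ((tendsto_pow_atTop (two_ne_zero)).atTop_div_const (by positivity))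
  have h2 := (Real.tendsto_exp_atBot.comp h1).div_const (√(4 * Real.pi * |t|))
  rw [zero_div] at h2
  exact h2

theorem tendsto_heatKernel_atBot (ht : 0 < t) : Tendsto (heatKernel t) atBot (𝓝 0) := by
  have h := (tendsto_heatKernel_atTop ht).comp tendsto_neg_atBot_atTop
  exact h.congr fun x => heatKernel_neg t x

theorem integral_heatKernelDeriv (ht : 0 < t) : ∫ x, heatKernelDeriv t x = 0 := by
  rw [integral_of_hasDerivAt_of_tendsto (hasDerivAt_heatKernel t) (integrable_heatKernelDeriv ht)
    (tendsto_heatKernel_atBot ht) (tendsto_heatKernel_atTop ht), sub_zero]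

theorem integral_Ioi_heatKernelDeriv (ht : 0 < t) (b : ℝ) :
    ∫ x in Ioi b, heatKernelDeriv t x = -heatKernel t b := by
  rw [integral_Ioi_of_hasDerivAt_of_tendsto' (fun x _ => hasDerivAt_heatKernel t x)
    (integrable_heatKernelDeriv ht).integrableOn (tendsto_heatKernel_atTop ht), zero_sub]

theorem heatKernelDeriv_nonpos (ht : 0 < t) {x : ℝ} (hx : 0 ≤ x) : heatKernelDeriv t x ≤ 0 := by
  rw [heatKernelDeriv, neg_mul, neg_nonpos]
  exact mul_nonneg (by positivity) (heatKernel_nonneg t x)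

/-- `∫ sin Θ_t' = -∫ cos Θ_t`, by parts. -/
theorem integral_sin_mul_heatKernelDeriv (ht : 0 < t) :
    ∫ x, Real.sin x * heatKernelDeriv t x = -Real.exp (-t) := by
  have hk := integrable_heatKernel ht
  have hk' := integrable_heatKernelDeriv ht
  rw [← integral_cos_mul_heatKernel ht]
  refine integral_mul_deriv_eq_deriv_mul_of_integrable (fun x _ => Real.hasDerivAt_sin x)
    (fun x _ => hasDerivAt_heatKernel t x) ?_ ?_ ?_
  · exact hk'.bdd_mul (c := 1) Real.continuous_sin.aestronglyMeasurable
      (ae_of_all _ Real.abs_sin_le_one)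
  · exact hk.bdd_mul (c := 1) Real.continuous_cos.aestronglyMeasurable
      (ae_of_all _ Real.abs_cos_le_one)
  · exact hk.bdd_mul (c := 1) Real.continuous_sin.aestronglyMeasurable
      (ae_of_all _ Real.abs_sin_le_one)

theorem integral_cos_mul_heatKernelDeriv :
    ∫ x, Real.cos x * heatKernelDeriv t x = 0 := by
  have h := integral_neg_eq_self (fun x => Real.cos x * heatKernelDeriv t x) volume
  simp only [Real.cos_neg, heatKernelDeriv_neg, mul_neg, integral_neg] at h
  linarith

theorem heatKernel_eq_exp (ht : 0 < t) (x : ℝ) :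
    heatKernel t x = 1 / √(4 * Real.pi * t) * Real.exp (-(1 / (4 * t)) * x ^ 2) := by
  rw [heatKernel, abs_of_pos ht]
  ring_nf

/-! ### The two convolutions of a bounded continuous function -/

variable {F : ℝ → ℝ} {M : ℝ}

theorem integral_mul_heatKernel_sub (ht : 0 < t) (x : ℝ) :
    ∫ y, F y * heatKernel t (x - y) =
      1 / √(4 * Real.pi * t) * realMoment F 0 x (1 / (4 * t)) := by
  rw [realMoment, ← integral_const_mul]
  congr 1 with y
  rw [heatKernel_eq_exp ht]
  ring

theorem integral_mul_heatKernelDeriv_sub (ht : 0 < t) (x : ℝ) :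
    ∫ y, F y * heatKernelDeriv t (x - y) =
      -(1 / (2 * t * √(4 * Real.pi * t))) * realMoment F 1 x (1 / (4 * t)) := by
  rw [realMoment, ← integral_const_mul]
  congr 1 with y
  rw [heatKernelDeriv, heatKernel_eq_exp ht]
  ring

theorem hasDerivAt_integral_heatKernel (hF : Continuous F) (hM : ∀ y, |F y| ≤ M) (ht : 0 < t)
    (x : ℝ) : HasDerivAt (fun x => ∫ y, F y * heatKernel t (x - y))
      (∫ y, F y * heatKernelDeriv t (x - y)) x := by
  simp only [integral_mul_heatKernel_sub ht, integral_mul_heatKernelDeriv_sub ht]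
  refine ((hasDerivAt_realMoment_fst hF hM 0 x (a := 1 / (4 * t)) (by positivity)).const_mul
    _).congr_deriv ?_
  simp
  field_simp
  ring

theorem integrable_mul_heatKernel_sub (hF : Continuous F) (hM : ∀ y, |F y| ≤ M) (ht : 0 < t)
    (x : ℝ) : Integrable fun y => F y * heatKernel t (x - y) :=
  ((integrable_heatKernel ht).comp_sub_left x).bdd_mul hF.aestronglyMeasurable (ae_of_all _ hM)

theorem integrable_mul_heatKernelDeriv_sub (hF : Continuous F) (hM : ∀ y, |F y| ≤ M) (ht : 0 < t)
    (x : ℝ) : Integrable fun y => F y * heatKernelDeriv t (x - y) :=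
  ((integrable_heatKernelDeriv ht).comp_sub_left x).bdd_mul hF.aestronglyMeasurable
    (ae_of_all _ hM)

theorem analyticAt_sqrt {a : ℝ} (ha : 0 < a) : AnalyticAt ℝ Real.sqrt a :=
  (Real.contDiffAt_sqrt ha.ne').analyticAt

theorem analyticAt_heat_coeff (ht : 0 < t) :
    AnalyticAt ℝ (fun t : ℝ => -(1 / (2 * t * √(4 * Real.pi * t)))) t := by
  have h1 : AnalyticAt ℝ (fun t : ℝ => √(4 * Real.pi * t)) t :=
    AnalyticAt.comp (f := fun t : ℝ => 4 * Real.pi * t)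
      (analyticAt_sqrt (by positivity : 0 < 4 * Real.pi * t)) (analyticAt_const.mul analyticAt_id)
  have h2 : AnalyticAt ℝ (fun t : ℝ => 2 * t * √(4 * Real.pi * t)) t :=
    (analyticAt_const.mul analyticAt_id).mul h1
  exact (analyticAt_const.div h2 (by positivity)).neg

theorem analyticAt_inv_four_mul (ht : 0 < t) : AnalyticAt ℝ (fun t : ℝ => 1 / (4 * t)) t :=
  analyticAt_const.div (analyticAt_const.mul analyticAt_id) (by simpa using ht.ne')

theorem hasDerivAt_heat_coeff (ht : 0 < t) :
    HasDerivAt (fun t : ℝ => -(1 / (2 * t * √(4 * Real.pi * t))))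
      (-(3 / (2 * t)) * -(1 / (2 * t * √(4 * Real.pi * t)))) t := by
  have hs : HasDerivAt (fun t : ℝ => √(4 * Real.pi * t))
      (4 * Real.pi / (2 * √(4 * Real.pi * t))) t :=
    (by simpa using (hasDerivAt_id t).const_mul (4 * Real.pi) :
      HasDerivAt (fun t : ℝ => 4 * Real.pi * t) (4 * Real.pi) t).sqrt (by positivity)
  have h2 : HasDerivAt (fun t : ℝ => 2 * t) 2 t := by
    simpa using (hasDerivAt_id t).const_mul (2 : ℝ)
  have h3 := ((h2.mul hs).fun_inv (by simp only [Pi.mul_apply]; positivity)).neg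
  have h4 : √(4 * Real.pi * t) ^ 2 = 4 * Real.pi * t := Real.sq_sqrt (by positivity)
  have h5 : 0 < √(4 * Real.pi * t) := by positivity
  simp only [one_div]
  refine h3.congr_deriv ?_
  simp only [Pi.mul_apply]
  generalize √(4 * Real.pi * t) = s at *
  have h6 : 4 * Real.pi = s ^ 2 / t := by rw [h4]; field_simp
  rw [h6]
  field_simp
  ring

end

/-! ### The solution `f ∗ Θ_t` through the primitive of `f` -/

section

variable (f : Ac) {t : ℝ}

theorem Ac.continuous_prim : Continuous fun y : ℝ => f.prim y := continuous_restrict f.prim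

theorem Ac.abs_prim_le (y : ℝ) : |f.prim y| ≤ ‖f.prim‖ := f.prim.norm_coe_le_norm _

theorem Ac.prim_mem : f.prim ∈ Bc := f.prim_bot

/-- The reflected primitive is `F(∞) - F(x - ·)`; its constant part does not contribute, because
`∫ Θ_t' = 0`. -/
theorem hasProdIntegral_reflect (ht : 0 < t) (x : ℝ) :
    HasProdIntegral (reflect x f.toDist) (heatKernel t)
      (∫ y : ℝ, f.prim y * heatKernelDeriv t (x - y)) := by
  have h := hasProdIntegral_distDeriv (reflPrim_mem x f.prim) (hasDerivAt_heatKernel t)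
    (integrable_heatKernelDeriv ht) (tendsto_heatKernel_atBot ht) (tendsto_heatKernel_atTop ht)
  rw [← reflect_distDeriv, f.distDeriv_prim] at h
  convert h using 1
  have hi : Integrable fun y => f.prim ((x - y : ℝ) : EReal) * heatKernelDeriv t y :=
    (integrable_heatKernelDeriv ht).bdd_mul
      (f.continuous_prim.comp (continuous_const.sub continuous_id)).aestronglyMeasurable
      (ae_of_all _ fun y => f.abs_prim_le _)
  simp only [reflPrim_coe, sub_mul]
  rw [integral_sub ((integrable_heatKernelDeriv ht).const_mul _) hi, integral_const_mul,
    integral_heatKernelDeriv ht, mul_zero, zero_sub, neg_neg,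
    ← integral_sub_left_eq_self (fun y : ℝ => f.prim y * heatKernelDeriv t (x - y)) volume x]
  simp

theorem heatConv_eq (ht : 0 < t) (x : ℝ) :
    heatConv f x t = ∫ y : ℝ, f.prim y * heatKernelDeriv t (x - y) :=
  (hasProdIntegral_reflect f ht x).prodIntegral_eq

theorem heatConv_eq_integral_sub (ht : 0 < t) (x : ℝ) :
    heatConv f x t = ∫ z : ℝ, f.prim ((x - z : ℝ) : EReal) * heatKernelDeriv t z := by
  rw [heatConv_eq f ht,
    ← integral_sub_left_eq_self (fun y : ℝ => f.prim y * heatKernelDeriv t (x - y)) volume x]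
  simp

theorem hasProdIntegral_comp_sub (ht : 0 < t) (x : ℝ) :
    HasProdIntegral f.toDist (fun ξ => heatKernel t (x - ξ)) (heatConv f x t) := by
  have hd : ∀ y, HasDerivAt (fun ξ => heatKernel t (x - ξ)) (-heatKernelDeriv t (x - y)) y :=
    fun y => (hasDerivAt_heatKernel t (x - y)).comp_const_sub x y
  have h := hasProdIntegral_distDeriv f.prim_mem hd
    ((integrable_heatKernelDeriv ht).comp_sub_left x).neg
    ((tendsto_heatKernel_atTop ht).comp (tendsto_atTop_add_const_left _ x tendsto_neg_atBot_atTop))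
    ((tendsto_heatKernel_atBot ht).comp (tendsto_atBot_add_const_left _ x tendsto_neg_atTop_atBot))
  rw [f.distDeriv_prim] at h
  convert h using 1
  rw [heatConv_eq f ht]
  simp [integral_neg]

/-- The convolution `F ∗ Θ_t` of the heat kernel with the primitive `F` of `f`. -/
def primConv (t x : ℝ) : ℝ := ∫ y : ℝ, f.prim y * heatKernel t (x - y)

theorem hasDerivAt_primConv (ht : 0 < t) (x : ℝ) :
    HasDerivAt (primConv f t) (heatConv f x t) x := by
  rw [heatConv_eq f ht]
  exact hasDerivAt_integral_heatKernel f.continuous_prim f.abs_prim_le ht x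

theorem primConv_eq_integral_sub (x : ℝ) :
    primConv f t x = ∫ z : ℝ, f.prim ((x - z : ℝ) : EReal) * heatKernel t z := by
  rw [primConv,
    ← integral_sub_left_eq_self (fun y : ℝ => f.prim y * heatKernel t (x - y)) volume x]
  simp

theorem heatConv_eq_realMoment (ht : 0 < t) (x : ℝ) :
    heatConv f x t = -(1 / (2 * t * √(4 * Real.pi * t))) *
      realMoment (fun y => f.prim y) 1 x (1 / (4 * t)) := by
  rw [heatConv_eq f ht, integral_mul_heatKernelDeriv_sub (F := fun y : ℝ => f.prim y) ht]

theorem contDiffOn_heatConv :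
    ContDiffOn ℝ ∞ (fun p : ℝ × ℝ => heatConv f p.1 p.2) (univ ×ˢ Ioi 0) := by
  have hc : ContDiffOn ℝ ∞ (fun t : ℝ => -(1 / (2 * t * √(4 * Real.pi * t)))) (Ioi 0) :=
    fun t ht => (analyticAt_heat_coeff ht).contDiffAt.contDiffWithinAt
  have ha : ContDiffOn ℝ ∞ (fun t : ℝ => 1 / (4 * t)) (Ioi 0) :=
    fun t ht => (analyticAt_inv_four_mul ht).contDiffAt.contDiffWithinAt
  have hm : MapsTo (fun p : ℝ × ℝ => p.2) (univ ×ˢ Ioi 0) (Ioi 0) := fun p hp => hp.2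
  have hc' := hc.comp contDiff_snd.contDiffOn hm
  have ha' := ha.comp contDiff_snd.contDiffOn hm
  have hG := (contDiffOn_realMoment f.continuous_prim f.abs_prim_le 1).comp
    (contDiff_fst.contDiffOn.prodMk ha') (fun p hp => by
      have : 0 < p.2 := hp.2
      simpa using this)
  exact (hc'.mul hG).congr fun p hp => heatConv_eq_realMoment f hp.2 p.1

theorem analyticAt_heatConv_fst (ht : 0 < t) (x : ℝ) :
    AnalyticAt ℝ (fun x => heatConv f x t) x := by
  simp only [heatConv_eq_realMoment f ht]
  exact analyticAt_const.mul (analyticAt_realMoment_fst f.continuous_prim f.abs_prim_le 1 x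
    (by positivity))

theorem analyticAt_heatConv_snd (ht : 0 < t) (x : ℝ) :
    AnalyticAt ℝ (fun t => heatConv f x t) t := by
  have h1 := analyticAt_realMoment_snd f.continuous_prim f.abs_prim_le 1 x
    (a := 1 / (4 * t)) (by positivity)
  have h2 := (analyticAt_heat_coeff ht).mul
    (AnalyticAt.comp (f := fun t : ℝ => 1 / (4 * t)) h1 (analyticAt_inv_four_mul ht))
  refine h2.congr ?_
  filter_upwards [Ioi_mem_nhds ht] with s hs
  exact (heatConv_eq_realMoment f hs x).symm

/-- With `a = 1 / 4t` and `G_k` the moments of the primitive, both sides are the coefficient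
of `f ∗ Θ_t` times `-6 a G_1 + 4 a ^ 2 G_3`. -/
theorem heat_equation (ht : 0 < t) (x : ℝ) :
    deriv (fun s => heatConv f x s) t - iteratedDeriv 2 (fun y => heatConv f y t) x = 0 := by
  have hF := f.continuous_prim
  have hM := f.abs_prim_le
  have ha : 0 < 1 / (4 * t) := by positivity
  have e1 : HasDerivAt (fun t : ℝ => 1 / (4 * t)) (-(1 / (4 * t ^ 2))) t := by
    have h1 : HasDerivAt (fun t : ℝ => 4 * t) 4 t := by
      simpa using (hasDerivAt_id t).const_mul (4 : ℝ)
    simp only [one_div]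
    refine (h1.fun_inv (by positivity)).congr_deriv ?_
    field_simp
  have h1 : HasDerivAt (fun s => heatConv f x s)
      (-(1 / (2 * t * √(4 * Real.pi * t))) *
        (-(3 / (2 * t)) * realMoment (fun y => f.prim y) 1 x (1 / (4 * t)) +
          1 / (4 * t ^ 2) * realMoment (fun y => f.prim y) 3 x (1 / (4 * t)))) t := by
    have h2 := (hasDerivAt_heat_coeff ht).mul
      (HasDerivAt.comp t (hasDerivAt_realMoment_snd hF hM 1 x ha) e1)
    refine (h2.congr_deriv ?_).congr_of_eventuallyEq ?_
    · simp only [Function.comp]; ring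
    · filter_upwards [Ioi_mem_nhds ht] with s hs
      exact heatConv_eq_realMoment f hs x
  have h2 : ∀ y, HasDerivAt (fun y => heatConv f y t)
      (-(1 / (2 * t * √(4 * Real.pi * t))) *
        (realMoment (fun y => f.prim y) 0 y (1 / (4 * t)) -
          2 * (1 / (4 * t)) * realMoment (fun y => f.prim y) 2 y (1 / (4 * t)))) y := fun y => by
    simp only [heatConv_eq_realMoment f ht]
    exact ((hasDerivAt_realMoment_fst hF hM 1 y ha).const_mul _).congr_deriv (by simp)
  have h3 := (((hasDerivAt_realMoment_fst hF hM 0 x ha).sub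
    ((hasDerivAt_realMoment_fst hF hM 2 x ha).const_mul (2 * (1 / (4 * t))))).const_mul
      (-(1 / (2 * t * √(4 * Real.pi * t)))))
  rw [iteratedDeriv_succ, iteratedDeriv_one, funext fun y => (h2 y).deriv, h1.deriv]
  have h4 := h3.deriv
  simp only [Pi.sub_apply] at h4
  rw [h4]
  simp
  field_simp
  ring

end

/-! ### Elements of `A_c` from functions on the line -/

/-- The continuous extension to `[-∞, ∞]` of a continuous function on `ℝ` with limits `l` at `-∞`
and `m` at `∞`. -/
def extendEReal (h : ℝ → ℝ) (l m : ℝ) (hc : Continuous h) (hl : Tendsto h atBot (𝓝 l))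
    (hm : Tendsto h atTop (𝓝 m)) : C(EReal, ℝ) where
  toFun z := if z = ⊥ then l else if z = ⊤ then m else h z.toReal
  continuous_toFun := by
    rw [continuous_iff_continuousAt]
    intro z
    induction z with
    | bot =>
      intro s hs
      simp only [if_true] at hs
      obtain ⟨A, hA⟩ := mem_atBot_sets.1 (hl hs)
      rw [Filter.mem_map]
      filter_upwards [Iio_mem_nhds (EReal.bot_lt_coe A)] with z hz
      induction z with
      | bot => simpa using mem_of_mem_nhds hs
      | top => simp at hz
      | coe x => simpa using hA x (EReal.coe_lt_coe_iff.1 hz).le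
    | top =>
      intro s hs
      simp only [top_ne_bot, if_true, if_false] at hs
      obtain ⟨A, hA⟩ := mem_atTop_sets.1 (hm hs)
      rw [Filter.mem_map]
      filter_upwards [Ioi_mem_nhds (EReal.coe_lt_top A)] with z hz
      induction z with
      | bot => simp at hz
      | top => simpa using mem_of_mem_nhds hs
      | coe x => simpa using hA x (EReal.coe_lt_coe_iff.1 hz).le
    | coe x =>
      rw [← EReal.isOpenEmbedding_coe.continuousAt_iff]
      convert hc.continuousAt using 1
      ext y
      simp

section

variable {h : ℝ → ℝ} {l m : ℝ} (hc : Continuous h) (hl : Tendsto h atBot (𝓝 l))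
  (hm : Tendsto h atTop (𝓝 m))

theorem extendEReal_coe (x : ℝ) : extendEReal h l m hc hl hm x = h x := by
  simp [extendEReal]

theorem extendEReal_bot : extendEReal h l m hc hl hm ⊥ = l := by simp [extendEReal]

theorem extendEReal_top : extendEReal h l m hc hl hm ⊤ = m := by simp [extendEReal]

theorem eq_of_forall_coe {F G : C(EReal, ℝ)} (h : ∀ x : ℝ, F x = G x) : F = G :=
  DFunLike.coe_injective (denseRange_coe_ereal.equalizer F.continuous G.continuous (funext h))

end

/-- The derivative in `A_c` of a continuous function on `ℝ` with limits `0` at `-∞` and `m`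
at `∞`. -/
def Ac.ofPrim (h : ℝ → ℝ) (m : ℝ) (hc : Continuous h) (hl : Tendsto h atBot (𝓝 0))
    (hm : Tendsto h atTop (𝓝 m)) : Ac :=
  primEquiv ⟨extendEReal h 0 m hc hl hm, extendEReal_bot hc hl hm⟩

section

variable {h : ℝ → ℝ} {m : ℝ} (hc : Continuous h) (hl : Tendsto h atBot (𝓝 0))
  (hm : Tendsto h atTop (𝓝 m))

theorem Ac.prim_ofPrim : (Ac.ofPrim h m hc hl hm).prim = extendEReal h 0 m hc hl hm := by
  rw [Ac.prim, Ac.ofPrim, LinearEquiv.symm_apply_apply]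

theorem Ac.prim_ofPrim_coe (x : ℝ) : (Ac.ofPrim h m hc hl hm).prim x = h x := by
  rw [Ac.prim_ofPrim, extendEReal_coe]

theorem Ac.prim_ofPrim_top : (Ac.ofPrim h m hc hl hm).prim ⊤ = m := by
  rw [Ac.prim_ofPrim, extendEReal_top]

end

theorem Ac.prim_injective : Function.Injective Ac.prim := fun f g h => by
  have h1 : primEquiv.symm f = primEquiv.symm g := Subtype.ext h
  exact primEquiv.symm.injective h1

theorem Ac.prim_add (f g : Ac) : (f + g).prim = f.prim + g.prim := by
  simp [Ac.prim]

theorem Ac.prim_smul (c : ℝ) (f : Ac) : (c • f).prim = c • f.prim := by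
  simp [Ac.prim]

theorem Ac.prim_sub (f g : Ac) : (f - g).prim = f.prim - g.prim := by
  simp [Ac.prim]

theorem Ac.abs_integral_le_norm (f : Ac) (a b : EReal) : |f.integral a b| ≤ ‖f‖ := by
  refine denseRange_coe_ereal.induction_on₂ (p := fun a b => |f.integral a b| ≤ ‖f‖) ?_ ?_ a b
  · refine isClosed_le (Continuous.abs ?_) continuous_const
    exact (f.prim.continuous.comp continuous_snd).sub (f.prim.continuous.comp continuous_fst)
  · intro x y
    rcases lt_trichotomy x y with h | rfl | h
    · exact le_ciSup f.bddAbove ⟨(x, y), h⟩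
    · simp [Ac.integral]
    · have h2 : f.integral x y = -f.integral y x := by simp [Ac.integral]
      rw [h2, abs_neg]
      exact le_ciSup f.bddAbove ⟨(y, x), h⟩

theorem Ac.norm_le_of_forall {f : Ac} {C : ℝ} (h : ∀ x y : ℝ, |f.prim y - f.prim x| ≤ C) :
    ‖f‖ ≤ C :=
  ciSup_le fun p => h p.1.1 p.1.2

/-! ### The operators `f ↦ f ∗ Θ_t` -/

section

variable {t : ℝ}

theorem tendsto_integral_prim_mul (f : Ac) {k : ℝ → ℝ} (hk : Integrable k) {l : Filter ℝ}
    [l.IsCountablyGenerated] {L : ℝ}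
    (hL : ∀ z : ℝ, Tendsto (fun x : ℝ => f.prim ((x - z : ℝ) : EReal)) l (𝓝 L)) :
    Tendsto (fun x => ∫ z, f.prim ((x - z : ℝ) : EReal) * k z) l (𝓝 (L * ∫ z, k z)) := by
  rw [← integral_const_mul]
  refine tendsto_integral_filter_of_dominated_convergence (fun z => ‖f.prim‖ * |k z|)
    (Eventually.of_forall fun x => ?_) (Eventually.of_forall fun x => ae_of_all _ fun z => ?_)
    (hk.abs.const_mul _) (ae_of_all _ fun z => (hL z).mul_const _)
  · exact (f.continuous_prim.comp
      (continuous_const.sub continuous_id)).aestronglyMeasurable.mul hk.aestronglyMeasurable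
  · rw [norm_mul]
    exact mul_le_mul_of_nonneg_right (f.abs_prim_le _) (norm_nonneg _)

theorem tendsto_prim_sub_atTop (f : Ac) (z : ℝ) :
    Tendsto (fun x : ℝ => f.prim ((x - z : ℝ) : EReal)) atTop (𝓝 (f.prim ⊤)) :=
  (f.prim.continuous.tendsto ⊤).comp
    (EReal.tendsto_coe_nhds_top_iff.2 (tendsto_atTop_add_const_right _ (-z) tendsto_id))

theorem tendsto_prim_sub_atBot (f : Ac) (z : ℝ) :
    Tendsto (fun x : ℝ => f.prim ((x - z : ℝ) : EReal)) atBot (𝓝 0) := by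
  rw [← f.prim_bot]
  exact (f.prim.continuous.tendsto ⊥).comp
    (EReal.tendsto_coe_nhds_bot_iff.2 (tendsto_atBot_add_const_right _ (-z) tendsto_id))

theorem tendsto_heatConv_atTop (f : Ac) (ht : 0 < t) :
    Tendsto (fun x => heatConv f x t) atTop (𝓝 0) := by
  simp only [heatConv_eq_integral_sub f ht]
  simpa [integral_heatKernelDeriv ht] using
    tendsto_integral_prim_mul f (integrable_heatKernelDeriv ht) (tendsto_prim_sub_atTop f)

theorem tendsto_heatConv_atBot (f : Ac) (ht : 0 < t) :
    Tendsto (fun x => heatConv f x t) atBot (𝓝 0) := by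
  simp only [heatConv_eq_integral_sub f ht]
  simpa using
    tendsto_integral_prim_mul f (integrable_heatKernelDeriv ht) (tendsto_prim_sub_atBot f)

theorem tendsto_primConv_atTop (f : Ac) (ht : 0 < t) :
    Tendsto (primConv f t) atTop (𝓝 (f.prim ⊤)) := by
  simp only [funext fun x => primConv_eq_integral_sub f (t := t) x]
  simpa [integral_heatKernel ht] using
    tendsto_integral_prim_mul f (integrable_heatKernel ht) (tendsto_prim_sub_atTop f)

theorem tendsto_primConv_atBot (f : Ac) (ht : 0 < t) :
    Tendsto (primConv f t) atBot (𝓝 0) := by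
  simp only [funext fun x => primConv_eq_integral_sub f (t := t) x]
  simpa using
    tendsto_integral_prim_mul f (integrable_heatKernel ht) (tendsto_prim_sub_atBot f)

theorem continuous_heatConv (f : Ac) (ht : 0 < t) : Continuous fun x => heatConv f x t :=
  continuous_iff_continuousAt.2 fun x => (analyticAt_heatConv_fst f ht x).continuousAt

theorem continuous_primConv (f : Ac) (ht : 0 < t) : Continuous (primConv f t) :=
  continuous_iff_continuousAt.2 fun x => (hasDerivAt_primConv f ht x).continuousAt

theorem heatConv_add (f g : Ac) (ht : 0 < t) (x : ℝ) :
    heatConv (f + g) x t = heatConv f x t + heatConv g x t := by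
  simp only [heatConv_eq _ ht, Ac.prim_add, ContinuousMap.add_apply, add_mul]
  exact integral_add
    (integrable_mul_heatKernelDeriv_sub f.continuous_prim f.abs_prim_le ht x)
    (integrable_mul_heatKernelDeriv_sub g.continuous_prim g.abs_prim_le ht x)

theorem heatConv_smul (c : ℝ) (f : Ac) (ht : 0 < t) (x : ℝ) :
    heatConv (c • f) x t = c * heatConv f x t := by
  simp only [heatConv_eq _ ht, Ac.prim_smul, ContinuousMap.smul_apply, smul_eq_mul, mul_assoc]
  exact integral_const_mul _ _

theorem primConv_add (f g : Ac) (ht : 0 < t) (x : ℝ) :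
    primConv (f + g) t x = primConv f t x + primConv g t x := by
  simp only [primConv, Ac.prim_add, ContinuousMap.add_apply, add_mul]
  exact integral_add
    (integrable_mul_heatKernel_sub f.continuous_prim f.abs_prim_le ht x)
    (integrable_mul_heatKernel_sub g.continuous_prim g.abs_prim_le ht x)

theorem primConv_smul (c : ℝ) (f : Ac) (x : ℝ) :
    primConv (c • f) t x = c * primConv f t x := by
  simp only [primConv, Ac.prim_smul, ContinuousMap.smul_apply, smul_eq_mul, mul_assoc]
  exact integral_const_mul _ _

theorem integral_abs_heatKernelDeriv (ht : 0 < t) :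
    ∫ z, |heatKernelDeriv t z| = 2 * heatKernel t 0 := by
  have h1 : (fun z => |heatKernelDeriv t z|) = fun z => (fun y => |heatKernelDeriv t y|) |z| := by
    ext z
    rcases abs_choice z with h | h <;> simp [h, heatKernelDeriv_neg]
  rw [h1, integral_comp_abs (f := fun y => |heatKernelDeriv t y|),
    setIntegral_congr_fun measurableSet_Ioi
    (fun z hz => abs_of_nonpos (heatKernelDeriv_nonpos ht (mem_Ioi.1 hz).le)), integral_neg,
    integral_Ioi_heatKernelDeriv ht, neg_neg]

/-- Since `Θ_t'` is odd, `2 (f ∗ Θ_t)(x) = ∫ (F(x - z) - F(x + z)) Θ_t'(z) dz`. -/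
theorem abs_heatConv_le (f : Ac) (ht : 0 < t) (x : ℝ) :
    |heatConv f x t| ≤ heatKernel t 0 * ‖f‖ := by
  have hi : ∀ s : ℝ → ℝ, Continuous s → Integrable fun z => f.prim (s z) * heatKernelDeriv t z :=
    fun s hs => (integrable_heatKernelDeriv ht).bdd_mul
      (f.continuous_prim.comp hs).aestronglyMeasurable (ae_of_all _ fun y => f.abs_prim_le _)
  have h1 : heatConv f x t = -∫ z : ℝ, f.prim ((x + z : ℝ) : EReal) * heatKernelDeriv t z := by
    rw [heatConv_eq_integral_sub f ht, ← integral_neg_eq_self, ← integral_neg]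
    simp [heatKernelDeriv_neg]
  have h2 : 2 * heatConv f x t = ∫ z : ℝ,
      (f.prim ((x - z : ℝ) : EReal) - f.prim ((x + z : ℝ) : EReal)) * heatKernelDeriv t z := by
    simp only [sub_mul]
    rw [integral_sub (hi _ (by fun_prop)) (hi _ (by fun_prop)), ← heatConv_eq_integral_sub f ht]
    linarith
  have h3 : |2 * heatConv f x t| ≤ ∫ z : ℝ, ‖f‖ * |heatKernelDeriv t z| := by
    rw [h2, ← Real.norm_eq_abs]
    refine norm_integral_le_of_norm_le ((integrable_heatKernelDeriv ht).abs.const_mul _)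
      (ae_of_all _ fun z => ?_)
    rw [norm_mul]
    exact mul_le_mul_of_nonneg_right
      (f.abs_integral_le_norm ((x + z : ℝ) : EReal) ((x - z : ℝ) : EReal)) (norm_nonneg _)
  rw [integral_const_mul, integral_abs_heatKernelDeriv ht, abs_mul, abs_two] at h3
  linarith

/-- `f ∗ Θ_t`, extended by `0` to `[-∞, ∞]`. -/
def heatExt (f : Ac) (ht : 0 < t) : C(EReal, ℝ) :=
  extendEReal (fun x => heatConv f x t) 0 0 (continuous_heatConv f ht) (tendsto_heatConv_atBot f ht)
    (tendsto_heatConv_atTop f ht)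

theorem heatExt_coe (f : Ac) (ht : 0 < t) (x : ℝ) : heatExt f ht x = heatConv f x t :=
  extendEReal_coe _ _ _ x

/-- The operator `Φ_t : A_c → C([-∞, ∞])`. -/
def heatCLM (ht : 0 < t) : Ac →L[ℝ] C(EReal, ℝ) :=
  LinearMap.mkContinuous
    { toFun := fun f => heatExt f ht
      map_add' := fun f g => eq_of_forall_coe fun x => by
        simp [heatExt_coe, heatConv_add f g ht]
      map_smul' := fun c f => eq_of_forall_coe fun x => by
        simp [heatExt_coe, heatConv_smul c f ht] } (heatKernel t 0) fun f => by
    refine (ContinuousMap.norm_le _ (mul_nonneg (heatKernel_nonneg _ _) (norm_nonneg _))).2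
      fun z => ?_
    refine denseRange_coe_ereal.induction_on (p := fun z => ‖heatExt f ht z‖ ≤ _) z
      (isClosed_le (heatExt f ht).continuous.norm continuous_const) fun x => ?_
    rw [heatExt_coe]
    exact abs_heatConv_le f ht x

theorem heatCLM_coe (f : Ac) (ht : 0 < t) (x : ℝ) : heatCLM ht f x = heatConv f x t :=
  heatExt_coe f ht x

/-- `f ∗ Θ_t` as an element of `A_c`, the derivative of `F ∗ Θ_t`. -/
def heatAc (f : Ac) (ht : 0 < t) : Ac :=
  Ac.ofPrim (primConv f t) (f.prim ⊤) (continuous_primConv f ht) (tendsto_primConv_atBot f ht)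
    (tendsto_primConv_atTop f ht)

theorem heatAc_prim_coe (f : Ac) (ht : 0 < t) (x : ℝ) : (heatAc f ht).prim x = primConv f t x :=
  Ac.prim_ofPrim_coe _ _ _ x

theorem abs_primConv_sub_le (f : Ac) (ht : 0 < t) (x y : ℝ) :
    |primConv f t y - primConv f t x| ≤ ‖f‖ := by
  have hi : ∀ x : ℝ, Integrable fun z => f.prim ((x - z : ℝ) : EReal) * heatKernel t z :=
    fun x => (integrable_heatKernel ht).bdd_mul
      (f.continuous_prim.comp (continuous_const.sub continuous_id)).aestronglyMeasurable
      (ae_of_all _ fun y => f.abs_prim_le _)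
  rw [primConv_eq_integral_sub, primConv_eq_integral_sub, ← integral_sub (hi y) (hi x),
    ← Real.norm_eq_abs]
  calc _ ≤ ∫ z, ‖f‖ * heatKernel t z := by
        refine norm_integral_le_of_norm_le ((integrable_heatKernel ht).const_mul _)
          (ae_of_all _ fun z => ?_)
        rw [← sub_mul, norm_mul, Real.norm_of_nonneg (heatKernel_nonneg t z)]
        exact mul_le_mul_of_nonneg_right
          (f.abs_integral_le_norm ((x - z : ℝ) : EReal) ((y - z : ℝ) : EReal))
          (heatKernel_nonneg _ _)
    _ = ‖f‖ := by rw [integral_const_mul, integral_heatKernel ht, mul_one]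

theorem norm_heatAc_le (f : Ac) (ht : 0 < t) : ‖heatAc f ht‖ ≤ ‖f‖ :=
  Ac.norm_le_of_forall fun x y => by
    rw [heatAc_prim_coe, heatAc_prim_coe]
    exact abs_primConv_sub_le f ht x y

/-- The operator `Ψ_t : A_c → A_c`. -/
def heatAcCLM (ht : 0 < t) : Ac →L[ℝ] Ac :=
  LinearMap.mkContinuous
    { toFun := fun f => heatAc f ht
      map_add' := fun f g => Ac.prim_injective <| eq_of_forall_coe fun x => by
        simp [Ac.prim_add, heatAc_prim_coe, primConv_add f g ht]
      map_smul' := fun c f => Ac.prim_injective <| eq_of_forall_coe fun x => by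
        simp [Ac.prim_smul, heatAc_prim_coe, primConv_smul c f] } 1 fun f => by
    rw [one_mul]
    exact norm_heatAc_le f ht

theorem heatAcCLM_apply (f : Ac) (ht : 0 < t) : heatAcCLM ht f = heatAc f ht := rfl

theorem heatAc_toDist (f : Ac) (ht : 0 < t) :
    (heatAc f ht).toDist = ofFun fun x => heatConv f x t := by
  rw [← Ac.distDeriv_prim]
  ext φ
  rw [distDeriv_apply, ofFun_apply (continuous_heatConv f ht).locallyIntegrable]
  simp only [heatAc_prim_coe]
  have hφ : ∀ x, HasDerivAt φ (deriv φ x) x := fun x =>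
    (φ.contDiff.differentiable (by simp) x).hasDerivAt
  have hφ' : Continuous (deriv φ) := φ.contDiff.continuous_deriv (by simp)
  have hφc : Continuous φ := φ.contDiff.continuous
  rw [integral_mul_deriv_eq_deriv_mul_of_integrable (fun x _ => hasDerivAt_primConv f ht x)
    (fun x _ => hφ x)
    (((continuous_primConv f ht).mul hφ').integrable_of_hasCompactSupport
      φ.hasCompactSupport.deriv.mul_left)
    (((continuous_heatConv f ht).mul hφc).integrable_of_hasCompactSupport
      φ.hasCompactSupport.mul_left)
    (((continuous_primConv f ht).mul hφc).integrable_of_hasCompactSupport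
      φ.hasCompactSupport.mul_left), neg_neg]
  simp only [mul_comm]

theorem heatAc_integral (f : Ac) (ht : 0 < t) : (heatAc f ht).integral ⊥ ⊤ = f.integral ⊥ ⊤ := by
  rw [Ac.integral, Ac.integral, Ac.prim_bot, Ac.prim_bot, heatAc, Ac.prim_ofPrim_top]

/-! ### Sharpness of the estimates -/

/-- The continuous function that is `0` on `(-∞, 0]`, `1` on `[δ, ∞)` and linear in between. -/
def ramp (δ y : ℝ) : ℝ := max 0 (min 1 (y / δ))

theorem continuous_ramp (δ : ℝ) : Continuous (ramp δ) := by
  unfold ramp; fun_prop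

theorem ramp_nonneg (δ y : ℝ) : 0 ≤ ramp δ y := le_max_left _ _

theorem ramp_le_one (δ y : ℝ) : ramp δ y ≤ 1 := max_le zero_le_one (min_le_left _ _)

theorem ramp_of_nonpos {δ y : ℝ} (hδ : 0 < δ) (hy : y ≤ 0) : ramp δ y = 0 :=
  max_eq_left ((min_le_right _ _).trans (div_nonpos_of_nonpos_of_nonneg hy hδ.le))

theorem ramp_of_le {δ y : ℝ} (hδ : 0 < δ) (hy : δ ≤ y) : ramp δ y = 1 := by
  rw [ramp, min_eq_left ((one_le_div hδ).2 hy), max_eq_right zero_le_one]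

theorem tendsto_ramp_atBot {δ : ℝ} (hδ : 0 < δ) : Tendsto (ramp δ) atBot (𝓝 0) :=
  tendsto_const_nhds.congr' (by
    filter_upwards [eventually_le_atBot 0] with y hy using (ramp_of_nonpos hδ hy).symm)

theorem tendsto_ramp_atTop {δ : ℝ} (hδ : 0 < δ) : Tendsto (ramp δ) atTop (𝓝 1) :=
  tendsto_const_nhds.congr' (by
    filter_upwards [eventually_ge_atTop δ] with y hy using (ramp_of_le hδ hy).symm)

/-- The derivative of the ramp function, a box of mass one on `[0, δ]`. -/
def rampAc {δ : ℝ} (hδ : 0 < δ) : Ac :=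
  Ac.ofPrim (ramp δ) 1 (continuous_ramp δ) (tendsto_ramp_atBot hδ) (tendsto_ramp_atTop hδ)

theorem rampAc_integral {δ : ℝ} (hδ : 0 < δ) : (rampAc hδ).integral ⊥ ⊤ = 1 := by
  rw [Ac.integral, Ac.prim_bot, rampAc, Ac.prim_ofPrim_top, sub_zero]

theorem norm_rampAc {δ : ℝ} (hδ : 0 < δ) : ‖rampAc hδ‖ = 1 := by
  refine le_antisymm (Ac.norm_le_of_forall fun x y => ?_) ?_
  · rw [rampAc, Ac.prim_ofPrim_coe, Ac.prim_ofPrim_coe, abs_le]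
    constructor <;> linarith [ramp_nonneg δ x, ramp_nonneg δ y, ramp_le_one δ x, ramp_le_one δ y]
  · simpa [rampAc_integral] using (rampAc hδ).abs_integral_le_norm ⊥ ⊤

/-- Beyond `δ` the primitive of the box equals `1`, and `-∫_δ^∞ Θ_t' = Θ_t(δ)`. -/
theorem le_heatConv_rampAc (ht : 0 < t) {δ : ℝ} (hδ : 0 < δ) :
    heatKernel t δ ≤ heatConv (rampAc hδ) 0 t := by
  rw [heatConv_eq _ ht]
  simp only [rampAc, Ac.prim_ofPrim_coe, zero_sub, heatKernelDeriv_neg]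
  rw [← neg_neg (heatKernel t δ), ← integral_Ioi_heatKernelDeriv ht, ← integral_neg,
    ← integral_indicator measurableSet_Ioi]
  refine integral_mono ((integrable_heatKernelDeriv ht).neg.indicator measurableSet_Ioi)
    ((integrable_heatKernelDeriv ht).neg.bdd_mul (c := 1) (continuous_ramp δ).aestronglyMeasurable
      (ae_of_all _ fun y => ?_)) fun y => ?_
  · rw [Real.norm_of_nonneg (ramp_nonneg δ y)]
    exact ramp_le_one δ y
  · by_cases hy : y ∈ Ioi δ
    · simp [indicator_of_mem hy, ramp_of_le hδ (le_of_lt hy)]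
    · simp only [indicator_of_notMem hy]
      rcases le_total y 0 with h0 | h0
      · simp [ramp_of_nonpos hδ h0]
      · exact mul_nonneg (ramp_nonneg _ _) (neg_nonneg.2 (heatKernelDeriv_nonpos ht h0))

theorem isLeast_heatConv_bound (ht : 0 < t) :
    IsLeast {C : ℝ | ∀ (f : Ac) (x : ℝ), |heatConv f x t| ≤ C * ‖f‖} (heatKernel t 0) := by
  refine ⟨fun f x => abs_heatConv_le f ht x, fun C hC => ?_⟩
  have h1 : Tendsto (heatKernel t) (𝓝[>] 0) (𝓝 (heatKernel t 0)) :=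
    ((continuous_heatKernel t).tendsto 0).mono_left nhdsWithin_le_nhds
  refine le_of_tendsto h1 ?_
  filter_upwards [self_mem_nhdsWithin] with δ hδ
  have hδ0 : 0 < δ := hδ
  have h2 := hC (rampAc hδ0) 0
  rw [norm_rampAc, mul_one] at h2
  exact (le_heatConv_rampAc ht hδ0).trans ((le_abs_self _).trans h2)

theorem norm_heatCLM (ht : 0 < t) : ‖heatCLM ht‖ = heatKernel t 0 := by
  refine le_antisymm (LinearMap.mkContinuous_norm_le _ (heatKernel_nonneg _ _) _)
    ((isLeast_heatConv_bound ht).2 fun f x => ?_)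
  rw [← heatCLM_coe f ht]
  exact ((heatCLM ht f).norm_coe_le_norm _).trans ((heatCLM ht).le_opNorm f)

theorem isLeast_heatAc_bound (ht : 0 < t) :
    IsLeast {C : ℝ | ∀ f : Ac, ‖heatAc f ht‖ ≤ C * ‖f‖} 1 := by
  refine ⟨fun f => by simpa using norm_heatAc_le f ht, fun C hC => ?_⟩
  have h := hC (rampAc one_pos)
  rw [norm_rampAc, mul_one] at h
  have h2 := (heatAc (rampAc one_pos) ht).abs_integral_le_norm ⊥ ⊤
  rw [heatAc_integral, rampAc_integral, abs_one] at h2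
  exact h2.trans h

theorem norm_heatAcCLM (ht : 0 < t) : ‖heatAcCLM ht‖ = 1 :=
  le_antisymm (LinearMap.mkContinuous_norm_le _ zero_le_one _)
    ((isLeast_heatAc_bound ht).2 fun f => (heatAcCLM ht).le_opNorm f)

/-! ### The initial data -/

theorem uniformContinuous_ramp_one : UniformContinuous (ramp 1) := by
  have h1 : LipschitzWith 1 (ramp 1) := by
    have h : ramp 1 = fun y => max (min y 1) 0 := by
      ext y; rw [ramp, div_one, max_comm, min_comm]
    rw [h]
    exact (LipschitzWith.id.min_const 1).max_const 0
  exact h1.uniformContinuous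

/-- A multiple of the ramp function absorbs the limit at `∞`; what remains tends to `0` at both
ends. -/
theorem Ac.uniformContinuous_prim (f : Ac) : UniformContinuous fun x : ℝ => f.prim x := by
  have h1 : UniformContinuous fun x : ℝ => f.prim x - f.prim ⊤ * ramp 1 x := by
    refine Continuous.uniformContinuous_of_tendsto_cocompact (x := 0)
      (f.continuous_prim.sub (continuous_const.mul (continuous_ramp 1))) ?_
    rw [cocompact_eq_atBot_atTop]
    refine Tendsto.sup ?_ ?_
    · simpa using (tendsto_prim_sub_atBot f 0).sub
        ((tendsto_ramp_atBot one_pos).const_mul (f.prim ⊤))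
    · simpa using (tendsto_prim_sub_atTop f 0).sub
        ((tendsto_ramp_atTop one_pos).const_mul (f.prim ⊤))
  have h2 := h1.add (uniformContinuous_ramp_one.const_mul' (f.prim ⊤))
  simpa using h2

/-- For `|z| < δ` the increment `F(x - z) - F(x)` is at most `ε`, and otherwise at most
`2 ‖F‖ z ^ 2 / δ ^ 2`; the second moment of `Θ_t` is `2 t`. -/
theorem abs_primConv_sub_prim_le (f : Ac) (ht : 0 < t) {ε δ : ℝ} (hε : 0 ≤ ε) (hδ : 0 < δ)
    (h : ∀ x y : ℝ, |x - y| < δ → |f.prim x - f.prim y| ≤ ε) (x : ℝ) :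
    |primConv f t x - f.prim x| ≤ ε + 4 * ‖f.prim‖ / δ ^ 2 * t := by
  have hi : Integrable fun z => f.prim ((x - z : ℝ) : EReal) * heatKernel t z :=
    (integrable_heatKernel ht).bdd_mul
      (f.continuous_prim.comp (continuous_const.sub continuous_id)).aestronglyMeasurable
      (ae_of_all _ fun y => f.abs_prim_le _)
  have hk := integrable_heatKernel ht
  have hs := integrable_sq_mul_heatKernel ht
  have h1 : primConv f t x - f.prim x =
      ∫ z : ℝ, (f.prim ((x - z : ℝ) : EReal) - f.prim x) * heatKernel t z := by
    simp only [sub_mul]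
    rw [integral_sub hi (hk.const_mul _), integral_const_mul, integral_heatKernel ht, mul_one,
      primConv_eq_integral_sub]
  have h2 : ∀ z : ℝ, |f.prim ((x - z : ℝ) : EReal) - f.prim x| ≤
      ε + 2 * ‖f.prim‖ / δ ^ 2 * z ^ 2 := fun z => by
    rcases lt_or_ge |z| δ with hz | hz
    · refine (h (x - z) x (by simpa using hz)).trans (le_add_of_nonneg_right (by positivity))
    · have h3 : δ ^ 2 ≤ z ^ 2 := by rw [← sq_abs z]; gcongr
      calc _ ≤ ‖f.prim‖ + ‖f.prim‖ :=
            (abs_sub _ _).trans (add_le_add (f.abs_prim_le _) (f.abs_prim_le _))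
        _ = 2 * ‖f.prim‖ / δ ^ 2 * δ ^ 2 := by field_simp; ring
        _ ≤ 2 * ‖f.prim‖ / δ ^ 2 * z ^ 2 := by gcongr
        _ ≤ _ := le_add_of_nonneg_left hε
  rw [h1, ← Real.norm_eq_abs]
  calc _ ≤ ∫ z, (ε * heatKernel t z + 2 * ‖f.prim‖ / δ ^ 2 * (z ^ 2 * heatKernel t z)) := by
        refine norm_integral_le_of_norm_le ((hk.const_mul _).add (hs.const_mul _))
          (ae_of_all _ fun z => ?_)
        rw [norm_mul, Real.norm_of_nonneg (heatKernel_nonneg t z), Real.norm_eq_abs]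
        calc _ ≤ _ := mul_le_mul_of_nonneg_right (h2 z) (heatKernel_nonneg _ _)
          _ = _ := by ring
    _ = ε + 4 * ‖f.prim‖ / δ ^ 2 * t := by
        rw [integral_add (hk.const_mul _) (hs.const_mul _), integral_const_mul, integral_const_mul,
          integral_heatKernel ht, integral_sq_mul_heatKernel ht]
        ring

theorem eventually_norm_heatAc_sub_lt (f : Ac) {ε : ℝ} (hε : 0 < ε) :
    ∀ᶠ t in 𝓝[>] (0 : ℝ), ∀ ht : 0 < t, ‖heatAc f ht - f‖ < ε := by
  obtain ⟨δ, hδ, h⟩ := Metric.uniformContinuous_iff.1 f.uniformContinuous_prim (ε / 4)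
    (by positivity)
  have hlim : Tendsto (fun t => 2 * (ε / 4 + 4 * ‖f.prim‖ / δ ^ 2 * t)) (𝓝[>] 0)
      (𝓝 (2 * (ε / 4 + 4 * ‖f.prim‖ / δ ^ 2 * 0))) :=
    Tendsto.mono_left (Continuous.tendsto (by fun_prop) 0) nhdsWithin_le_nhds
  filter_upwards [hlim.eventually_lt_const (u := ε) (by linarith)] with t hlt ht
  have hb := abs_primConv_sub_prim_le f ht (by positivity : 0 ≤ ε / 4) hδ
    fun x y hxy => (h hxy).le
  refine (Ac.norm_le_of_forall fun x y => ?_).trans_lt hlt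
  rw [Ac.prim_sub, ContinuousMap.sub_apply, ContinuousMap.sub_apply, heatAc_prim_coe,
    heatAc_prim_coe]
  linarith [abs_sub (primConv f t y - f.prim y) (primConv f t x - f.prim x), hb x, hb y]

end

/-! ### A solution outside every `L^p` with `p < ∞` -/

/-- The slowly decaying weight `1 / (1 + log (1 + |y|))`. -/
def logWeight (y : ℝ) : ℝ := (1 + Real.log (1 + |y|))⁻¹

theorem one_le_logWeight_inv (y : ℝ) : 1 ≤ 1 + Real.log (1 + |y|) :=
  le_add_of_nonneg_right (Real.log_nonneg (le_add_of_nonneg_right (abs_nonneg y)))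

theorem logWeight_pos (y : ℝ) : 0 < logWeight y :=
  inv_pos.2 (one_pos.trans_le (one_le_logWeight_inv y))

theorem logWeight_le_one (y : ℝ) : logWeight y ≤ 1 := inv_le_one_of_one_le₀ (one_le_logWeight_inv y)

theorem continuous_logWeight : Continuous logWeight := by
  refine Continuous.inv₀ (continuous_const.add (Continuous.log (by fun_prop) fun y => ?_))
    fun y => (one_pos.trans_le (one_le_logWeight_inv y)).ne'
  positivity

theorem tendsto_logWeight {l : Filter ℝ} {s : ℝ → ℝ} (hs : Tendsto (fun x => |s x|) l atTop) :
    Tendsto (fun x => logWeight (s x)) l (𝓝 0) :=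
  tendsto_inv_atTop_zero.comp (tendsto_atTop_add_const_left _ 1
    (Real.tendsto_log_atTop.comp (tendsto_atTop_add_const_left _ 1 hs)))

/-- From `1 + |x - z| ≤ (1 + |x|) (1 + |z|)` and the symmetric inequality. -/
theorem abs_log_sub_le (x z : ℝ) :
    |Real.log (1 + |x|) - Real.log (1 + |x - z|)| ≤ |z| := by
  have key : ∀ u v w : ℝ, |u| ≤ |v| + |w| → Real.log (1 + |u|) - Real.log (1 + |v|) ≤ |w| := by
    intro u v w h
    have h1 : Real.log (1 + |u|) ≤ Real.log ((1 + |v|) * (1 + |w|)) := by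
      refine Real.log_le_log (by positivity) ?_
      nlinarith [mul_nonneg (abs_nonneg v) (abs_nonneg w)]
    rw [Real.log_mul (by positivity) (by positivity)] at h1
    linarith [Real.log_le_sub_one_of_pos (by positivity : 0 < 1 + |w|)]
  rw [abs_le]
  constructor
  · linarith [key (x - z) x z (abs_sub x z)]
  · refine key x (x - z) z ?_
    simpa using abs_add_le (x - z) z

theorem abs_logWeight_sub_le (x z : ℝ) :
    |logWeight (x - z) - logWeight x| ≤ logWeight x * (logWeight (x - z) * |z|) := by
  have h1 := one_pos.trans_le (one_le_logWeight_inv x)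
  have h2 := one_pos.trans_le (one_le_logWeight_inv (x - z))
  have e : logWeight (x - z) - logWeight x = logWeight x * (logWeight (x - z) *
      (Real.log (1 + |x|) - Real.log (1 + |x - z|))) := by
    unfold logWeight
    field_simp
    ring
  rw [e, abs_mul, abs_mul, abs_of_pos (logWeight_pos _), abs_of_pos (logWeight_pos _)]
  have := abs_log_sub_le x z
  have := (logWeight_pos x).le
  have := (logWeight_pos (x - z)).le
  gcongr

theorem abs_cos_mul_logWeight_le (y : ℝ) : ‖Real.cos y * logWeight y‖ ≤ logWeight y := by
  rw [norm_mul, Real.norm_of_nonneg (logWeight_pos y).le]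
  exact mul_le_of_le_one_left (logWeight_pos y).le (Real.abs_cos_le_one y)

/-- The distribution with primitive `cos y / (1 + log (1 + |y|))`. -/
def oscAc : Ac :=
  Ac.ofPrim (fun y => Real.cos y * logWeight y) 0 (Real.continuous_cos.mul continuous_logWeight)
    (squeeze_zero_norm abs_cos_mul_logWeight_le (tendsto_logWeight tendsto_abs_atBot_atTop))
    (squeeze_zero_norm abs_cos_mul_logWeight_le (tendsto_logWeight tendsto_abs_atTop_atTop))

section

variable {t : ℝ}

theorem integral_cos_sub_mul_heatKernelDeriv (ht : 0 < t) (x : ℝ) :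
    ∫ z, Real.cos (x - z) * heatKernelDeriv t z = -(Real.exp (-t) * Real.sin x) := by
  have hk := integrable_heatKernelDeriv ht
  have hc : Integrable fun z => Real.cos z * heatKernelDeriv t z :=
    hk.bdd_mul (c := 1) Real.continuous_cos.aestronglyMeasurable (ae_of_all _ Real.abs_cos_le_one)
  have hs : Integrable fun z => Real.sin z * heatKernelDeriv t z :=
    hk.bdd_mul (c := 1) Real.continuous_sin.aestronglyMeasurable (ae_of_all _ Real.abs_sin_le_one)
  simp only [Real.cos_sub, add_mul, mul_assoc]
  rw [integral_add (hc.const_mul _) (hs.const_mul _), integral_const_mul, integral_const_mul,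
    integral_cos_mul_heatKernelDeriv, integral_sin_mul_heatKernelDeriv ht]
  ring

/-- The error made by pulling the weight out of the convolution, relative to the weight. -/
def oscError (t x : ℝ) : ℝ := ∫ z, logWeight (x - z) * (|z| * |heatKernelDeriv t z|)

theorem tendsto_oscError (ht : 0 < t) : Tendsto (oscError t) atTop (𝓝 0) := by
  have hi := integrable_abs_mul_heatKernelDeriv ht
  have h := tendsto_integral_filter_of_dominated_convergence (l := atTop)
    (F := fun x z : ℝ => logWeight (x - z) * (|z| * |heatKernelDeriv t z|)) (f := fun _ => (0 : ℝ))
    (μ := volume) (fun z => |z| * |heatKernelDeriv t z|) (Eventually.of_forall fun x => ?_)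
    (Eventually.of_forall fun x => ae_of_all _ fun z => ?_) hi (ae_of_all _ fun z => ?_)
  · rw [integral_zero] at h
    exact h
  · exact (continuous_logWeight.comp
      (continuous_const.sub continuous_id)).aestronglyMeasurable.mul hi.aestronglyMeasurable
  · rw [norm_mul, Real.norm_of_nonneg (logWeight_pos _).le, Real.norm_of_nonneg (by positivity)]
    exact mul_le_of_le_one_left (by positivity) (logWeight_le_one _)
  · have h1 : Tendsto (fun x : ℝ => |x - z|) atTop atTop :=
      tendsto_abs_atTop_atTop.comp (tendsto_atTop_add_const_right _ (-z) tendsto_id)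
    simpa using (tendsto_logWeight h1).mul_const (|z| * |heatKernelDeriv t z|)

/-- `oscAc ∗ Θ_t` is `-e^{-t} sin x / (1 + log (1 + |x|))` up to an error
that is small relative to the weight. -/
theorem abs_heatConv_oscAc_add_le (ht : 0 < t) (x : ℝ) :
    |heatConv oscAc x t + logWeight x * (Real.exp (-t) * Real.sin x)| ≤
      logWeight x * oscError t x := by
  have hk := integrable_heatKernelDeriv ht
  have hcc : Continuous fun z => Real.cos (x - z) := by fun_prop
  have hwc : Continuous fun z => logWeight (x - z) :=
    continuous_logWeight.comp (continuous_const.sub continuous_id)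
  have h1 : Integrable fun z => Real.cos (x - z) * heatKernelDeriv t z :=
    hk.bdd_mul (c := 1) hcc.aestronglyMeasurable (ae_of_all _ fun z => Real.abs_cos_le_one _)
  have h2 : Integrable fun z => Real.cos (x - z) * logWeight (x - z) * heatKernelDeriv t z :=
    hk.bdd_mul (c := 1) (hcc.mul hwc).aestronglyMeasurable
      (ae_of_all _ fun z => (abs_cos_mul_logWeight_le _).trans (logWeight_le_one _))
  have hi := integrable_abs_mul_heatKernelDeriv ht
  have h3 : Integrable fun z => logWeight (x - z) * (|z| * |heatKernelDeriv t z|) :=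
    hi.bdd_mul (c := 1) hwc.aestronglyMeasurable (ae_of_all _ fun z => by
      rw [Real.norm_of_nonneg (logWeight_pos _).le]
      exact logWeight_le_one _)
  have e : heatConv oscAc x t + logWeight x * (Real.exp (-t) * Real.sin x) =
      ∫ z, (Real.cos (x - z) * logWeight (x - z) * heatKernelDeriv t z -
        logWeight x * (Real.cos (x - z) * heatKernelDeriv t z)) := by
    rw [integral_sub h2 (h1.const_mul _), integral_const_mul,
      integral_cos_sub_mul_heatKernelDeriv ht, heatConv_eq_integral_sub _ ht]
    simp only [oscAc, Ac.prim_ofPrim_coe]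
    ring
  rw [e, oscError, ← integral_const_mul, ← Real.norm_eq_abs]
  refine norm_integral_le_of_norm_le (h3.const_mul _) (ae_of_all _ fun z => ?_)
  have e2 : Real.cos (x - z) * logWeight (x - z) * heatKernelDeriv t z -
      logWeight x * (Real.cos (x - z) * heatKernelDeriv t z) =
      Real.cos (x - z) * ((logWeight (x - z) - logWeight x) * heatKernelDeriv t z) := by ring
  rw [e2, norm_mul, norm_mul, Real.norm_eq_abs, Real.norm_eq_abs, Real.norm_eq_abs]
  calc _ ≤ 1 * (logWeight x * (logWeight (x - z) * |z|) * |heatKernelDeriv t z|) := by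
        have := Real.abs_cos_le_one (x - z)
        have := abs_logWeight_sub_le x z
        gcongr
    _ = _ := by ring

theorem eventually_le_abs_heatConv_oscAc (ht : 0 < t) :
    ∀ᶠ x in atTop, logWeight x * (Real.exp (-t) * (|Real.sin x| - 1 / 4)) ≤
      |heatConv oscAc x t| := by
  filter_upwards [(tendsto_oscError ht).eventually_lt_const
    (by positivity : 0 < Real.exp (-t) / 4)] with x hx
  have h1 := abs_heatConv_oscAc_add_le ht x
  have h2 := abs_sub_abs_le_abs_sub (logWeight x * (Real.exp (-t) * Real.sin x))
    (-heatConv oscAc x t)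
  rw [abs_neg, sub_neg_eq_add, add_comm (logWeight x * _), abs_mul, abs_mul,
    abs_of_pos (logWeight_pos x), Real.abs_exp] at h2
  have h3 := mul_le_mul_of_nonneg_left hx.le (logWeight_pos x).le
  linarith

/-- The zeros of `sin` are avoided by looking at `x` and `x + π / 2` together. -/
theorem eventually_le_abs_add_abs (ht : 0 < t) :
    ∀ᶠ x in atTop, Real.exp (-t) / 4 * logWeight (x + Real.pi / 2) ≤
      |heatConv oscAc x t| + |heatConv oscAc (x + Real.pi / 2) t| := by
  have hev := eventually_le_abs_heatConv_oscAc ht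
  have hsh : Tendsto (fun x : ℝ => x + Real.pi / 2) atTop atTop :=
    tendsto_atTop_add_const_right _ _ tendsto_id
  filter_upwards [hev, hsh.eventually hev, eventually_ge_atTop 0] with x h1 h2 hx
  rw [Real.sin_add_pi_div_two] at h2
  have he := Real.exp_pos (-t)
  have hwx := (logWeight_pos x).le
  have hw := logWeight_pos (x + Real.pi / 2)
  rcases le_or_gt (1 / 2) |Real.sin x| with hs | hs
  · have hmono : logWeight (x + Real.pi / 2) ≤ logWeight x := by
      have hpi := Real.pi_pos
      refine inv_anti₀ (one_pos.trans_le (one_le_logWeight_inv x)) ?_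
      rw [abs_of_nonneg hx, abs_of_nonneg (by positivity)]
      gcongr
      linarith
    calc _ = logWeight (x + Real.pi / 2) * (Real.exp (-t) * (1 / 2 - 1 / 4)) := by ring
      _ ≤ logWeight x * (Real.exp (-t) * (|Real.sin x| - 1 / 4)) := by gcongr
      _ ≤ _ := h1
      _ ≤ _ := le_add_of_nonneg_right (abs_nonneg _)
  · have hc : 1 / 2 ≤ |Real.cos x| := by
      have h3 := Real.sin_sq_add_cos_sq x
      rw [← sq_abs (Real.sin x), ← sq_abs (Real.cos x)] at h3
      by_contra! hcon
      nlinarith [abs_nonneg (Real.sin x), abs_nonneg (Real.cos x)]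
    calc _ = logWeight (x + Real.pi / 2) * (Real.exp (-t) * (1 / 2 - 1 / 4)) := by ring
      _ ≤ logWeight (x + Real.pi / 2) * (Real.exp (-t) * (|Real.cos x| - 1 / 4)) := by gcongr
      _ ≤ _ := h2
      _ ≤ _ := le_add_of_nonneg_left (abs_nonneg _)

/-- The logarithm grows more slowly than `x ^ (1 / q)`. -/
theorem inv_le_logWeight_rpow {q : ℝ} (hq : 0 < q) {x : ℝ} (hx : 1 ≤ x) :
    x⁻¹ ≤ 4 * (1 + q) ^ q * logWeight (x + Real.pi / 2) ^ q := by
  have hpi := Real.pi_pos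
  have hpi4 := Real.pi_le_four
  obtain ⟨y, hy⟩ : ∃ y, y = 1 + |x + Real.pi / 2| := ⟨_, rfl⟩
  have hy1 : 1 ≤ y := by rw [hy]; exact le_add_of_nonneg_right (abs_nonneg _)
  have hyx : y ≤ 4 * x := by
    rw [hy, abs_of_nonneg (by positivity)]
    linarith
  have h1 : 1 + Real.log y ≤ (1 + q) * y ^ q⁻¹ := by
    have h2 := Real.log_le_rpow_div (by positivity : 0 ≤ y) (inv_pos.2 hq)
    have h3 := Real.one_le_rpow hy1 (inv_pos.2 hq).le
    rw [div_inv_eq_mul] at h2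
    linarith
  have h0 : 1 ≤ 1 + Real.log y := le_add_of_nonneg_right (Real.log_nonneg hy1)
  have h4 : (1 + Real.log y) ^ q ≤ (1 + q) ^ q * (4 * x) := by
    calc _ ≤ ((1 + q) * y ^ q⁻¹) ^ q := by gcongr
      _ = (1 + q) ^ q * y := by
        rw [Real.mul_rpow (by positivity) (by positivity), ← Real.rpow_mul (by positivity),
          inv_mul_cancel₀ hq.ne', Real.rpow_one]
      _ ≤ _ := by gcongr
  have h5 : 0 < (1 + Real.log y) ^ q := by positivity
  rw [logWeight, ← hy, Real.inv_rpow (by positivity), ← div_eq_mul_inv, le_div_iff₀ h5,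
    inv_mul_le_iff₀ (by positivity)]
  linarith

theorem not_memLp_heatConv_oscAc (ht : 0 < t) {p : ℝ≥0∞} (hp : 1 ≤ p) (hp' : p ≠ ⊤) :
    ¬ MemLp (fun x => heatConv oscAc x t) p volume := by
  intro h
  have hp0 : p ≠ 0 := (one_pos.trans_le hp).ne'
  have hq : 0 < p.toReal := ENNReal.toReal_pos hp0 hp'
  have h2 : MemLp (fun x => heatConv oscAc (x + Real.pi / 2) t) p volume :=
    h.comp_measurePreserving (measurePreserving_add_right volume (Real.pi / 2))
  have h3 := (h.norm.add h2.norm).integrable_norm_rpow hp0 hp'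
  obtain ⟨X, hX⟩ := eventually_atTop.1 (eventually_le_abs_add_abs ht)
  obtain ⟨c, hc⟩ : ∃ c, c = Real.exp (-t) / 4 := ⟨_, rfl⟩
  have hc0 : 0 < c := by rw [hc]; positivity
  refine not_integrableOn_Ioi_inv (a := max X 1) ?_
  refine Integrable.mono' (h3.const_mul
    (4 * (1 + p.toReal) ^ p.toReal * (c ^ p.toReal)⁻¹)).integrableOn
    measurable_inv.aestronglyMeasurable ?_
  refine (ae_restrict_iff' measurableSet_Ioi).2 (ae_of_all _ fun x hx => ?_)
  have hx1 : 1 ≤ x := (le_max_right X 1).trans (le_of_lt hx)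
  have h4 := hX x ((le_max_left X 1).trans (le_of_lt hx))
  rw [← hc] at h4
  have hw := logWeight_pos (x + Real.pi / 2)
  rw [Real.norm_of_nonneg (by positivity)]
  refine (inv_le_logWeight_rpow hq hx1).trans ?_
  rw [mul_assoc _ (c ^ p.toReal)⁻¹]
  refine mul_le_mul_of_nonneg_left ?_ (by positivity)
  rw [le_inv_mul_iff₀ (by positivity), ← Real.mul_rpow hc0.le hw.le]
  refine Real.rpow_le_rpow (by positivity) (h4.trans ?_) hq.le
  exact le_abs_self _

end

end

end HeatAlex

theorem theorem3p1 :
    -- the operators of (d) and (f), for each `t > 0`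
    ∃ (Φ : ℝ → (HeatAlex.Ac →L[ℝ] C(EReal, ℝ))) (Ψ : ℝ → (HeatAlex.Ac →L[ℝ] HeatAlex.Ac)),
    -- (a) existence, commutativity, and the formulas through the primitive
    (∀ (f : HeatAlex.Ac) (x t : ℝ), 0 < t →
      HeatAlex.HasProdIntegral (HeatAlex.reflect x f.toDist) (HeatAlex.heatKernel t)
        (HeatAlex.heatConv f x t) ∧
      HeatAlex.HasProdIntegral f.toDist (fun ξ => HeatAlex.heatKernel t (x - ξ))
        (HeatAlex.heatConv f x t) ∧
      MeasureTheory.ConvolutionExistsAt (fun y : ℝ => f.prim y) (deriv (HeatAlex.heatKernel t)) x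
        (ContinuousLinearMap.mul ℝ ℝ) MeasureTheory.volume ∧
      MeasureTheory.convolution (fun y : ℝ => f.prim y) (deriv (HeatAlex.heatKernel t))
        (ContinuousLinearMap.mul ℝ ℝ) MeasureTheory.volume x = HeatAlex.heatConv f x t ∧
      MeasureTheory.ConvolutionExistsAt (fun y : ℝ => f.prim y) (HeatAlex.heatKernel t) x
        (ContinuousLinearMap.mul ℝ ℝ) MeasureTheory.volume ∧
      HasDerivAt (MeasureTheory.convolution (fun y : ℝ => f.prim y) (HeatAlex.heatKernel t)
        (ContinuousLinearMap.mul ℝ ℝ) MeasureTheory.volume) (HeatAlex.heatConv f x t) x) ∧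
    -- (b) joint smoothness on `ℝ × (0, ∞)`
    (∀ f : HeatAlex.Ac, ContDiffOn ℝ ∞ (fun p : ℝ × ℝ => HeatAlex.heatConv f p.1 p.2)
      (Set.univ ×ˢ Set.Ioi 0)) ∧
    -- (c) the sharp uniform estimate
    (∀ t : ℝ, 0 < t →
      IsLeast {C : ℝ | ∀ (f : HeatAlex.Ac) (x : ℝ), |HeatAlex.heatConv f x t| ≤ C * ‖f‖}
        (1 / (2 * √(Real.pi * t)))) ∧
    -- (d) the norm of `f ↦ f ∗ Θ_t` from `A_c` to the continuous functions on `[-∞, ∞]`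
    (∀ t : ℝ, 0 < t →
      (∀ (f : HeatAlex.Ac) (x : ℝ), Φ t f (x : EReal) = HeatAlex.heatConv f x t) ∧
      ‖Φ t‖ = 1 / (2 * √(Real.pi * t))) ∧
    -- (e) the limits at `±∞`
    (∀ (f : HeatAlex.Ac) (t : ℝ), 0 < t →
      Filter.Tendsto (fun x => HeatAlex.heatConv f x t) Filter.atTop (𝓝 0) ∧
      Filter.Tendsto (fun x => HeatAlex.heatConv f x t) Filter.atBot (𝓝 0)) ∧
    -- (f) `f ∗ Θ_t ∈ A_c`, the sharp Alexiewicz estimate, and the norm of `f ↦ f ∗ Θ_t` on `A_c`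
    (∀ t : ℝ, 0 < t →
      (∀ f : HeatAlex.Ac, (Ψ t f).toDist = HeatAlex.ofFun (fun x => HeatAlex.heatConv f x t)) ∧
      IsLeast {C : ℝ | ∀ f : HeatAlex.Ac, ‖Ψ t f‖ ≤ C * ‖f‖} 1 ∧
      ‖Ψ t‖ = 1) ∧
    -- (g) the heat equation in the classical sense, and the initial data in the Alexiewicz norm
    (∀ f : HeatAlex.Ac,
      (∀ t : ℝ, 0 < t → ContDiff ℝ 2 (fun x => HeatAlex.heatConv f x t)) ∧
      (∀ x : ℝ, ContDiffOn ℝ 1 (fun t => HeatAlex.heatConv f x t) (Set.Ioi 0)) ∧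
      (∀ x t : ℝ, 0 < t →
        deriv (fun s => HeatAlex.heatConv f x s) t -
          iteratedDeriv 2 (fun y => HeatAlex.heatConv f y t) x = 0) ∧
      Filter.Tendsto (fun t => ‖Ψ t f - f‖) (𝓝[>] 0) (𝓝 0)) ∧
    -- (h) conservation of the integral
    (∀ (f : HeatAlex.Ac) (t : ℝ), 0 < t → (Ψ t f).integral ⊥ ⊤ = f.integral ⊥ ⊤) ∧
    -- (i) `f ∗ Θ_t` need not lie in any `L^p`, `1 ≤ p < ∞`
    (∃ f : HeatAlex.Ac, ∀ t : ℝ, 0 < t → ∀ p : ℝ≥0∞, 1 ≤ p → p ≠ ⊤ →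
      ¬ MeasureTheory.MemLp (fun x => HeatAlex.heatConv f x t) p MeasureTheory.volume) ∧
    -- (j) separate real analyticity
    (∀ (f : HeatAlex.Ac) (t : ℝ), 0 < t →
      AnalyticOnNhd ℝ (fun x => HeatAlex.heatConv f x t) Set.univ) ∧
    (∀ (f : HeatAlex.Ac) (x : ℝ),
      AnalyticOnNhd ℝ (fun t => HeatAlex.heatConv f x t) (Set.Ioi 0)) := by
  refine ⟨fun t => if ht : 0 < t then HeatAlex.heatCLM ht else 0,
    fun t => if ht : 0 < t then HeatAlex.heatAcCLM ht else 0,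
    fun f x t ht => ⟨?_, HeatAlex.hasProdIntegral_comp_sub f ht x, ?_, ?_, ?_, ?_⟩,
    HeatAlex.contDiffOn_heatConv, fun t ht => ?_, fun t ht => ⟨fun f x => ?_, ?_⟩,
    fun f t ht => ⟨HeatAlex.tendsto_heatConv_atTop f ht, HeatAlex.tendsto_heatConv_atBot f ht⟩,
    fun t ht => ⟨fun f => ?_, ?_, ?_⟩,
    fun f => ⟨fun t ht => ?_, fun x => ?_, fun x t ht => HeatAlex.heat_equation f ht x, ?_⟩,
    fun f t ht => ?_,
    ⟨HeatAlex.oscAc, fun t ht p hp hp' => HeatAlex.not_memLp_heatConv_oscAc ht hp hp'⟩,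
    fun f t ht x _ => HeatAlex.analyticAt_heatConv_fst f ht x,
    fun f x t ht => HeatAlex.analyticAt_heatConv_snd f ht x⟩
  · rw [HeatAlex.heatConv_eq f ht]
    exact HeatAlex.hasProdIntegral_reflect f ht x
  · rw [HeatAlex.deriv_heatKernel]
    exact HeatAlex.integrable_mul_heatKernelDeriv_sub f.continuous_prim f.abs_prim_le ht x
  · rw [HeatAlex.deriv_heatKernel, HeatAlex.heatConv_eq f ht]
    rfl
  · exact HeatAlex.integrable_mul_heatKernel_sub f.continuous_prim f.abs_prim_le ht x
  · exact HeatAlex.hasDerivAt_primConv f ht x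
  · rw [← HeatAlex.heatKernel_zero ht]
    exact HeatAlex.isLeast_heatConv_bound ht
  · simp only [dif_pos ht]
    rw [HeatAlex.heatCLM_coe]
  · simp only [dif_pos ht]
    rw [HeatAlex.norm_heatCLM, HeatAlex.heatKernel_zero ht]
  · simp only [dif_pos ht]
    rw [HeatAlex.heatAcCLM_apply, HeatAlex.heatAc_toDist]
  · simp only [dif_pos ht]
    exact HeatAlex.isLeast_heatAc_bound ht
  · simp only [dif_pos ht]
    rw [HeatAlex.norm_heatAcCLM]
  · exact contDiff_iff_contDiffAt.2 fun x => (HeatAlex.analyticAt_heatConv_fst f ht x).contDiffAt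
  · exact fun t ht => (HeatAlex.analyticAt_heatConv_snd f ht x).contDiffAt.contDiffWithinAt
  · rw [Metric.tendsto_nhds]
    intro ε hε
    filter_upwards [HeatAlex.eventually_norm_heatAc_sub_lt f hε, self_mem_nhdsWithin] with t h ht
    have ht : 0 < t := ht
    rw [dist_zero_right, norm_norm, dif_pos ht, HeatAlex.heatAcCLM_apply]
    exact h ht
  · simp only [dif_pos ht]
    rw [HeatAlex.heatAcCLM_apply, HeatAlex.heatAc_integral]
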